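/- **Model.** There are $N\ge 1$ non-colluding databases, each storing the same $K\ge 1$ independent messages $W_1,\dots,W_K$ of $L$ uniformly random bits. For a caching ratio $r\in[0,1]$, the user first prefetches, uncoded, $\lfloor Lr/N\rfloor$ bits of each message from each database (that is, $Lr/N$ bits whenever this is an integer). The cached bits are chosen uniformly at random, independently for the different messages, and disjointly for different databases. Database $n$ knows the set $\mathbb H_n$ of the indices cached from it and nothing about the indices cached from the others. To retrieve $W_\theta$, the user draws queries $Q_1^{[\theta]},\dots,Q_N^{[\theta]}$ at random, depending on $\theta$ and on the family $\mathbb H=(\mathbb H_1,\dots,\mathbb H_N)$ of cached index sets but not on the message contents. Database $n$ returns an answer $A_n^{[\theta]}$ that is a function of $Q_n^{[\theta]}$ and of the messages. The scheme is *private* if for every $n$ the joint law of $(Q_n^{[\theta]},A_n^{[\theta]},W_1,\dots,W_K,\mathbb H_n)$ does not depend on $\theta$. Entropies are in bits, and $Z$ denotes the cached content. A normalized cost $d$ is *achievable* at $r$ if there are private schemes with message lengths $L\to\infty$ such that, for every $\theta$, $$H\big(W_\theta\mid Z,\mathbb H,Q_1^{[\theta]},\dots,Q_N^{[\theta]},A_1^{[\theta]},\dots,A_N^{[\theta]}\big)=o(L)\quad\text{and}\quad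 \frac1L\sum_{n=1}^N H\big(A_n^{[\theta]}\big)\to d.$$ The optimal normalized download cost $D^*(r)$ is the infimum of the achievable $d$. **Theorem 1 (Outer bound).** For $s\in\{1,\dots,K-1\}$ put $$r_s=\frac{\binom{K-2}{s-1}}{\binom{K-2}{s-1}+\sum_{i=0}^{K-1-s}\binom{K-1}{s+i}(N-1)^{i+1}},\qquad \bar D(r_s)=\frac{\sum_{i=0}^{K-1-s}\binom{K}{s+1+i}(N-1)^{i+1}}{\binom{K-2}{s-1}+\sum_{i=0}^{K-1-s}\binom{K-1}{s+i}(N-1)^{i+1}},$$ and at the end points put $r_0=0$ with cost $\bar D(r_0)=1+\frac1N+\dots+\frac1{N^{K-1}}$, and $r_K=1$ with cost $\bar D(r_K)=0$. (If $N=1$, then $r_1=\dots=r_K=1$, with cost $0$.) 1. For every $s\in\{0,1,\dots,K\}$ the cost $\bar D(r_s)$ is achievable at caching ratio $r_s$; in particular $D^*(r_s)\le\bar D(r_s)$. 2. For every $s\in\{0,\dots,K-1\}$, every $\alpha\in(0,1)$ and $r=\alpha r_s+(1-\alpha)r_{s+1}$, the cost $\alpha\bar D(r_s)+(1-\alpha)\bar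 D(r_{s+1})$ is achievable at caching ratio $r$; in particular $D^*(r)\le\alpha\bar D(r_s)+(1-\alpha)\bar D(r_{s+1})$. 3. If $N\ge2$, then $0=r_0<r_1<\dots<r_K=1$. Hence on $[0,1]$ the function $D^*$ is bounded above by the piecewise-linear curve made of the $K$ line segments joining consecutive points $(r_s,\bar D(r_s))$, $s=0,\dots,K$. -/

import Mathlib

open Filter Topology

noncomputable section

namespace CachePIR

/-- Shannon entropy, in bits, of a law on a finite type. -/
def entropy {α : Type} [Fintype α] (p : PMF α) : ℝ :=
  ∑ x, Real.negMulLog (p x).toReal / Real.log 2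

/-- Conditional entropy `H(X | Y) = H(X, Y) - H(Y)`, in bits, of two finitely valued random
variables on a discrete probability space. -/
def condEntropy {Ω α β : Type} [Fintype α] [Fintype β] (p : PMF Ω) (X : Ω → α) (Y : Ω → β) : ℝ :=
  entropy (p.map fun ω => (X ω, Y ω)) - entropy (p.map Y)

/-- The contents of `K` messages of `L` bits each. -/
abbrev Messages (K L : ℕ) : Type := Fin K → Fin L → Bool

/-- The possible sets of cached indices: `H n k` is the set of the indices of the bits of message
`k` that are prefetched from database `n`. It has `m` elements for all `n` and `k`, and different
databases deliver different bits. -/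
def Placement (N K L m : ℕ) : Type :=
  {H : Fin N → Fin K → Finset (Fin L) //
    (∀ n k, (H n k).card = m) ∧ ∀ k, ∀ n n', n ≠ n' → Disjoint (H n k) (H n' k)}

instance (N K L m : ℕ) : Finite (Placement N K L m) := by
  unfold Placement; infer_instance

instance (N K L m : ℕ) : Fintype (Placement N K L m) := Fintype.ofFinite _

/-- There is a placement as soon as the `N * m` cached bits of a message fit into it. -/
theorem Placement.nonempty {N K L m : ℕ} (h : N * m ≤ L) : Nonempty (Placement N K L m) := by
  have hlt : ∀ (n : Fin N) (i : Fin m), n.1 * m + i.1 < L := by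
    intro n i
    have h1 : (n.1 + 1) * m ≤ N * m := Nat.mul_le_mul_right m n.2
    have h2 := i.2
    have h3 : (n.1 + 1) * m = n.1 * m + m := by ring
    omega
  refine ⟨⟨fun n _ => Finset.univ.image fun i : Fin m => (⟨n.1 * m + i.1, hlt n i⟩ : Fin L),
    ?_, ?_⟩⟩
  · intro n k
    rw [Finset.card_image_of_injective, Finset.card_univ, Fintype.card_fin]
    intro i j hij
    have := congrArg Fin.val hij
    apply Fin.ext
    simpa using this
  · intro k n n' hn
    rw [Finset.disjoint_left]
    intro x hx hx'
    simp only [Finset.mem_image, Finset.mem_univ, true_and] at hx hx'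
    obtain ⟨i, rfl⟩ := hx
    obtain ⟨j, hj⟩ := hx'
    have hv : n'.1 * m + j.1 = n.1 * m + i.1 := congrArg Fin.val hj
    apply hn
    apply Fin.ext
    have hm : 0 < m := lt_of_le_of_lt (Nat.zero_le _) i.2
    have e1 : (n.1 * m + i.1) / m = n.1 := by
      rw [mul_comm, Nat.mul_add_div hm, Nat.div_eq_of_lt i.2, add_zero]
    have e2 : (n'.1 * m + j.1) / m = n'.1 := by
      rw [mul_comm, Nat.mul_add_div hm, Nat.div_eq_of_lt j.2, add_zero]
    rw [← e1, ← e2, hv]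

/-- A retrieval scheme for `N` databases and `K` messages of `L` bits, of which the user has
prefetched `m` bits of each message from each database. For the desired message `θ` and the cached
indices `H`, the user draws the queries to the databases from `queryLaw θ H`; the answer of
database `n` is a function of its query and of the messages. -/
structure Scheme (N K L m : ℕ) where
  /-- the cached bits fit into the messages -/
  fits : N * m ≤ L
  /-- the query alphabet -/
  Query : Type
  [fintypeQuery : Fintype Query]
  /-- the answer alphabet -/
  Answer : Type
  [fintypeAnswer : Fintype Answer]
  /-- conditional law of the `N` queries, given the desired message and the cached indices -/
  queryLaw : Fin K → Placement N K L m → PMF (Fin N → Query)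
  /-- the answer of each database to a query -/
  answer : Fin N → Query → Messages K L → Answer

attribute [instance] Scheme.fintypeQuery Scheme.fintypeAnswer

namespace Scheme

variable {N K L m : ℕ}

/-- The realizations of (messages, cached indices, queries). -/
abbrev Outcome (S : Scheme N K L m) : Type :=
  Messages K L × Placement N K L m × (Fin N → S.Query)

/-- The joint law of (messages, cached indices, queries) when message `θ` is desired. The messages
are independent, with independent uniform bits. The cached indices are uniformly random,
independently for the different messages, and independent of the messages and of `θ`. The queries
depend on the messages through nothing. -/
def law (S : Scheme N K L m) (θ : Fin K) : PMF S.Outcome :=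
  haveI : Nonempty (Placement N K L m) := Placement.nonempty S.fits
  (PMF.uniformOfFintype (Messages K L)).bind fun W =>
    (PMF.uniformOfFintype (Placement N K L m)).bind fun H =>
      (S.queryLaw θ H).map fun Q => (W, H, Q)

/-- The answer of database `n`. -/
def ans (S : Scheme N K L m) (n : Fin N) (ω : S.Outcome) : S.Answer :=
  S.answer n (ω.2.2 n) ω.1

/-- The cached content: the values of the cached bits, by database, message and index
(`none` where nothing is cached). -/
def cache (S : Scheme N K L m) (ω : S.Outcome) : Fin N → Fin K → Fin L → Option Bool :=
  fun n k i => if i ∈ ω.2.1.1 n k then some (ω.1 k i) else none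

/-- Privacy: for every single database, the joint law of the query to it, its answer, the messages
and the indices cached from it does not depend on the desired message. -/
def IsPrivate (S : Scheme N K L m) : Prop :=
  ∀ (n : Fin N) (θ θ' : Fin K),
    (S.law θ).map (fun ω => (ω.2.2 n, S.ans n ω, ω.1, ω.2.1.1 n)) =
      (S.law θ').map (fun ω => (ω.2.2 n, S.ans n ω, ω.1, ω.2.1.1 n))

/-- The uncertainty, in bits, that is left about the desired message `θ` given the cached
content, the cached indices, all queries and all answers. -/
def equivocation (S : Scheme N K L m) (θ : Fin K) : ℝ :=
  condEntropy (S.law θ) (fun ω => ω.1 θ)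
    (fun ω => (S.cache ω, ω.2.1, ω.2.2, fun n => S.ans n ω))

/-- The download cost: the sum over the databases of the entropies of the answers. -/
def downloadCost (S : Scheme N K L m) (θ : Fin K) : ℝ :=
  ∑ n, entropy ((S.law θ).map (S.ans n))

end Scheme

/-- The number of bits of each `L`-bit message that are prefetched from each of the `N` databases
at caching ratio `r`: this is `L r / N` whenever that is an integer, and otherwise the largest
whole number of bits that respects the size `K L r` of the cache. -/
def prefetched (N L : ℕ) (r : ℝ) : ℕ := ⌊(L : ℝ) * r / N⌋₊

/-- The normalized download cost `d` is achievable at caching ratio `r`: there are private schemes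
with message lengths tending to infinity, for which the equivocation of the desired message is
`o(L)` and the download cost divided by `L` tends to `d`, whichever message is desired. -/
def IsAchievable (N K : ℕ) (r d : ℝ) : Prop :=
  ∃ (L : ℕ → ℕ) (S : (j : ℕ) → Scheme N K (L j) (prefetched N (L j) r)),
    Tendsto L atTop atTop ∧
    (∀ j, (S j).IsPrivate) ∧
    (∀ θ, Tendsto (fun j => (S j).equivocation θ / (L j : ℝ)) atTop (𝓝 0)) ∧
    (∀ θ, Tendsto (fun j => (S j).downloadCost θ / (L j : ℝ)) atTop (𝓝 d))

/-- The optimal normalized download cost `D*(r)`: the infimum of the achievable ones (`⊤` if there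
is none). -/
def optimalCost (N K : ℕ) (r : ℝ) : EReal :=
  ⨅ (d : ℝ) (_ : IsAchievable N K r d), (d : EReal)

/-- The corner caching ratios `r_s`, `1 ≤ s ≤ K - 1`, together with the end points `r_0 = 0` and
`r_K = 1`. -/
def cornerRatio (N K s : ℕ) : ℝ :=
  if s = 0 then 0
  else if K ≤ s then 1
  else ((K - 2).choose (s - 1) : ℝ) /
    (((K - 2).choose (s - 1) : ℝ) +
      ∑ i ∈ Finset.range (K - s), ((K - 1).choose (s + i) : ℝ) * ((N : ℝ) - 1) ^ (i + 1))

/-- The costs at the corner caching ratios, together with the costs `1 + 1/N + ⋯ + 1/N^(K-1)` and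
`0` at the end points. -/
def cornerCost (N K s : ℕ) : ℝ :=
  if s = 0 then ∑ j ∈ Finset.range K, 1 / (N : ℝ) ^ j
  else if K ≤ s then 0
  else (∑ i ∈ Finset.range (K - s), (K.choose (s + 1 + i) : ℝ) * ((N : ℝ) - 1) ^ (i + 1)) /
    (((K - 2).choose (s - 1) : ℝ) +
      ∑ i ∈ Finset.range (K - s), ((K - 1).choose (s + i) : ℝ) * ((N : ℝ) - 1) ^ (i + 1))

end CachePIR

end

/-!
The schemes behind the outer bound are built from *sums*. A sum of type `S`, for a set `S` of
messages, adds up modulo 2 one bit of each message in `S`. Every database is asked for `d t` sums of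
each type of size `t`, in which no bit occurs twice and none has been cached from that database. A
sum whose type contains the desired message `θ` delivers a new bit of `θ` if the sum of its
remaining bits is known. This side information comes from one of the `N - 1` other databases, in one
of two ways: such a database has been asked for this very sum of type `S \ {θ}`, or the bits of the
sum have been cached from it. With `c t` cached sums for each database and each type of size `t`,
this works if `d (t + 1) ≤ (N - 1) * (c t + d t)` for `t ≥ 1` (`exists_sideInformation`); for
`t = 0` no side information is needed and `d 1` is free. All inner corner points and both end points
of the curve, and the time sharing between any two of them, are choices of the numbers `c t` and
`d 1`.

Privacy comes from relabelling the bits of each message by a uniformly random permutation. Fix a base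
placement and, for each `θ`, one family of queries as above, a template. The placement and the
queries of the scheme are the relabelled base placement and template (`templateScheme_law`); this
fits the uniform placement because relabellings act transitively on placements. From the view of
database `n` the templates for `θ` and `θ'` differ by a relabelling that preserves the indices cached
from `n`, so the laws agree (`IsTemplate.isPrivate`). Since no bit is repeated in a query, answers
are exactly uniform and the download cost is the number of the sums (`IsTemplate.downloadCost_eq`).
The bits of `θ` that are neither cached nor in a sum bound the equivocation
(`IsTemplate.equivocation_le`).

For messages of length `L` the numbers `c t` and `d 1` are proportional to `L`, rounded down
(`IsFeasibleWith.isAchievable`); rounding leaves `o(L)` bits of `θ` unknown. The conditions on the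
proportions are linear in proportions, caching ratio and cost, so achievability along the segments
follows from the corners (`IsFeasibleWith.convexComb`). The order of the corner ratios is a termwise
comparison of binomial coefficients (`choose_mul_choose_le`).
-/

namespace CachePIR

/-! ### Entropy of finite laws -/

theorem entropy_uniformOfFintype (α : Type) [Fintype α] [Nonempty α] :
    entropy (PMF.uniformOfFintype α) = Real.log (Fintype.card α) / Real.log 2 := by
  have hc : (Fintype.card α : ℝ) ≠ 0 := by exact_mod_cast Fintype.card_ne_zero
  simp only [entropy, PMF.uniformOfFintype_apply, ENNReal.toReal_inv, ENNReal.toReal_natCast,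
    Finset.sum_const, Finset.card_univ, nsmul_eq_mul, Real.negMulLog, Real.log_inv]
  field_simp

/-- Merging the points of a finite set does not increase the entropy. -/
theorem negMulLog_sum_le {ι : Type*} (s : Finset ι) (a : ι → ℝ) (ha : ∀ i, 0 ≤ a i) :
    Real.negMulLog (∑ i ∈ s, a i) ≤ ∑ i ∈ s, Real.negMulLog (a i) := by
  have h : Real.negMulLog (∑ i ∈ s, a i) = ∑ i ∈ s, -(a i) * Real.log (∑ j ∈ s, a j) := by
    rw [Real.negMulLog, ← Finset.sum_mul, Finset.sum_neg_distrib]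
  rw [h]
  refine Finset.sum_le_sum fun i hi => ?_
  rcases (ha i).eq_or_lt with h0 | h0
  · simp [← h0]
  · have := Real.log_le_log h0 (Finset.single_le_sum (fun j _ => ha j) hi)
    rw [Real.negMulLog]
    nlinarith

/-- The log-sum inequality: spreading a mass over at most `M` points adds at most `log M` per unit
of mass. -/
theorem sum_negMulLog_le {ι : Type*} (s : Finset ι) (a : ι → ℝ) (ha : ∀ i, 0 ≤ a i) (M : ℕ)
    (hM : 0 < M) (hs : {i ∈ s | a i ≠ 0}.card ≤ M) :
    ∑ i ∈ s, Real.negMulLog (a i) ≤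
      Real.negMulLog (∑ i ∈ s, a i) + (∑ i ∈ s, a i) * Real.log M := by
  set A := ∑ i ∈ s, a i with hA
  have hM' : (0 : ℝ) < M := by exact_mod_cast hM
  have hA0 : 0 ≤ A := Finset.sum_nonneg fun i _ => ha i
  have e1 : ∑ i ∈ s, Real.negMulLog (a i) = ∑ i ∈ s with a i ≠ 0, Real.negMulLog (a i) := by
    refine (Finset.sum_subset (Finset.filter_subset _ _) fun i hi hi' => ?_).symm
    have : a i = 0 := by by_contra h; exact hi' (by simp [hi, h])
    simp [this]
  have e2 : A = ∑ i ∈ s with a i ≠ 0, a i := by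
    rw [hA, Finset.sum_filter_ne_zero]
  have key : ∀ i ∈ s.filter (fun i => a i ≠ 0),
      Real.negMulLog (a i) ≤ a i * (Real.log M - Real.log A) + (A / M - a i) := by
    intro i hi
    simp only [Finset.mem_filter] at hi
    have hi0 : 0 < a i := lt_of_le_of_ne (ha i) (Ne.symm hi.2)
    have hAi : 0 < A := lt_of_lt_of_le hi0 (Finset.single_le_sum (fun j _ => ha j) hi.1)
    have h1 := Real.log_le_sub_one_of_pos (x := A / (M * a i)) (by positivity)
    rw [Real.log_div hAi.ne' (by positivity), Real.log_mul hM'.ne' hi0.ne'] at h1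
    have h2 := mul_le_mul_of_nonneg_left h1 hi0.le
    have h3 : a i * (A / (M * a i) - 1) = A / M - a i := by field_simp
    rw [h3] at h2
    rw [Real.negMulLog]
    linarith
  rw [e1]
  refine (Finset.sum_le_sum key).trans ?_
  rw [Finset.sum_add_distrib, ← Finset.sum_mul, Finset.sum_sub_distrib, ← e2, Finset.sum_const,
    nsmul_eq_mul, Real.negMulLog]
  have : (({i ∈ s | a i ≠ 0}.card : ℕ) : ℝ) * (A / M) ≤ M * (A / M) := by
    gcongr
  rw [mul_div_cancel₀ _ hM'.ne'] at this
  linarith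

theorem toReal_map_snd_apply {α β : Type} [Fintype α] [Fintype β] (q : PMF (α × β)) (y : β) :
    ((q.map Prod.snd) y).toReal = ∑ x, (q (x, y)).toReal := by
  classical
  rw [← ENNReal.toReal_sum fun x _ => PMF.apply_ne_top _ _, PMF.map_apply, tsum_fintype,
    Fintype.sum_prod_type]
  congr 1
  refine Finset.sum_congr rfl fun x _ => ?_
  simp

theorem sum_toReal_eq_one {α : Type} [Fintype α] (q : PMF α) : ∑ x, (q x).toReal = 1 := by
  rw [← ENNReal.toReal_sum fun x _ => PMF.apply_ne_top _ _, ← tsum_fintype (L := .unconditional _),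
    q.tsum_coe, ENNReal.toReal_one]

theorem condEntropy_eq_sum {Ω α β : Type} [Fintype α] [Fintype β] (p : PMF Ω) (X : Ω → α)
    (Y : Ω → β) :
    condEntropy p X Y = (∑ y, (∑ x, Real.negMulLog ((p.map fun ω => (X ω, Y ω)) (x, y)).toReal -
      Real.negMulLog (∑ x, ((p.map fun ω => (X ω, Y ω)) (x, y)).toReal))) / Real.log 2 := by
  have h : p.map Y = (p.map fun ω => (X ω, Y ω)).map Prod.snd := by
    rw [PMF.map_comp]; rfl
  rw [condEntropy, h, entropy, entropy, Finset.sum_sub_distrib, sub_div, Fintype.sum_prod_type,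
    Finset.sum_comm, Finset.sum_div, Finset.sum_div]
  simp only [toReal_map_snd_apply, Finset.sum_div]

theorem condEntropy_nonneg {Ω α β : Type} [Fintype α] [Fintype β] (p : PMF Ω) (X : Ω → α)
    (Y : Ω → β) : 0 ≤ condEntropy p X Y := by
  rw [condEntropy_eq_sum]
  refine div_nonneg (Finset.sum_nonneg fun y _ => sub_nonneg.2 ?_) (Real.log_nonneg one_le_two)
  exact negMulLog_sum_le _ _ fun x => ENNReal.toReal_nonneg

/-- If at most `M` values of `X` are compatible with each value of `Y`, then
`H(X | Y) ≤ log₂ M`. -/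
theorem condEntropy_le {Ω α β : Type} [Fintype α] [Fintype β] (p : PMF Ω) (X : Ω → α)
    (Y : Ω → β) (M : ℕ) (hM : 0 < M)
    (h : ∀ y, {x | ∃ ω ∈ p.support, X ω = x ∧ Y ω = y}.ncard ≤ M) :
    condEntropy p X Y ≤ Real.log M / Real.log 2 := by
  classical
  rw [condEntropy_eq_sum]
  refine div_le_div_of_nonneg_right ?_ (Real.log_nonneg one_le_two)
  set q := p.map fun ω => (X ω, Y ω) with hq
  have key : ∀ y, ∑ x, Real.negMulLog (q (x, y)).toReal -
      Real.negMulLog (∑ x, (q (x, y)).toReal) ≤ (∑ x, (q (x, y)).toReal) * Real.log M := by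
    intro y
    rw [sub_le_iff_le_add']
    refine sum_negMulLog_le _ _ (fun x => ENNReal.toReal_nonneg) M hM (le_trans ?_ (h y))
    rw [← Set.ncard_coe_finset]
    refine Set.ncard_le_ncard ?_ (Set.toFinite _)
    intro x hx
    simp only [Finset.coe_filter, Finset.mem_univ, true_and, Set.mem_ofPred_eq] at hx
    have hx' : (x, y) ∈ q.support := by
      rw [PMF.mem_support_iff]; intro h0; exact hx (by simp [h0])
    rw [hq, PMF.support_map] at hx'
    obtain ⟨ω, hω, he⟩ := hx'
    exact ⟨ω, hω, congrArg Prod.fst he, congrArg Prod.snd he⟩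
  refine (Finset.sum_le_sum fun y _ => key y).trans ?_
  rw [← Finset.sum_mul, Finset.sum_comm, ← Fintype.sum_prod_type', sum_toReal_eq_one q, one_mul]

/-! ### Uniform laws -/

/-- A uniform point of a uniform fibre is uniform, if all fibres have the same size. -/
theorem uniform_bind_uniform_fiber {G P : Type} [Fintype G] [Nonempty G] [Fintype P] [Nonempty P]
    (π : G → P) [∀ p, Fintype {g // π g = p}] [∀ p, Nonempty {g // π g = p}]
    (hcard : ∀ p p', Fintype.card {g // π g = p} = Fintype.card {g // π g = p'}) :
    ((PMF.uniformOfFintype P).bind fun p =>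
      (PMF.uniformOfFintype {g // π g = p}).map Subtype.val) = PMF.uniformOfFintype G := by
  classical
  ext g
  have hG : Fintype.card G = Fintype.card P * Fintype.card {x // π x = π g} := by
    rw [Fintype.card_congr (Equiv.sigmaFiberEquiv π).symm, Fintype.card_sigma,
      Finset.sum_congr rfl fun p _ => hcard p (π g), Finset.sum_const, Finset.card_univ,
      smul_eq_mul]
  rw [PMF.bind_apply, tsum_eq_single (π g)]
  · rw [PMF.map_apply, tsum_eq_single ⟨g, rfl⟩]
    · simp only [PMF.uniformOfFintype_apply, if_true]
      rw [hG, Nat.cast_mul, ENNReal.mul_inv] <;> simp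
    · rintro ⟨x, hx⟩ hne
      rw [if_neg]
      rintro rfl
      exact hne rfl
  · intro p hp
    rw [PMF.map_apply, ENNReal.tsum_eq_zero.2, mul_zero]
    rintro ⟨x, hx⟩
    rw [if_neg]
    rintro rfl
    exact hp hx.symm

theorem uniform_map_equiv {α β : Type} [Fintype α] [Nonempty α] [Fintype β] [Nonempty β]
    (e : α ≃ β) : (PMF.uniformOfFintype α).map e = PMF.uniformOfFintype β := by
  classical
  ext b
  rw [PMF.map_apply, tsum_eq_single (e.symm b)]
  · simp [Fintype.card_congr e]
  · intro a ha
    rw [if_neg]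
    rintro rfl
    simp at ha

/-- The image of a uniform law under a map that intertwines, for each `c`, a permutation of the
source with the translation by `c` is uniform. -/
theorem uniform_map_of_translate {α A : Type} [Fintype α] [Nonempty α] [Fintype A] [AddGroup A]
    (f : α → A) (g : A → α ≃ α) (h : ∀ c x, f (g c x) = f x + c) :
    (PMF.uniformOfFintype α).map f = PMF.uniformOfFintype A := by
  classical
  set q := (PMF.uniformOfFintype α).map f with hq
  have inv : ∀ c a, q (a + c) = q a := by
    intro c a
    rw [hq]
    conv_lhs => rw [← uniform_map_equiv (g c), PMF.map_comp, PMF.map_apply]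
    rw [PMF.map_apply]
    simp [h]
  have hconst : ∀ a, q a = q 0 := fun a => by simpa using inv a 0
  have hsum : (Fintype.card A : ENNReal) * q 0 = 1 := by
    have := q.tsum_coe
    rw [tsum_fintype, Finset.sum_congr rfl fun a _ => hconst a, Finset.sum_const,
      Finset.card_univ, nsmul_eq_mul] at this
    exact this
  ext a
  rw [hconst, PMF.uniformOfFintype_apply]
  exact ENNReal.eq_inv_of_mul_eq_one_left (by rw [mul_comm]; exact hsum)

/-! ### Relabelling the bits of the messages -/

/-- Independent relabellings of the bits of the messages, one permutation for each message. -/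
abbrev IndexPerm (K L : ℕ) : Type := Fin K → Equiv.Perm (Fin L)

/-- The relabelled placement. -/
def Placement.permute {N K L m : ℕ} (σ : IndexPerm K L) (H : Placement N K L m) :
    Placement N K L m :=
  ⟨fun n k => (H.1 n k).map (σ k).toEmbedding, fun n k => by
    rw [Finset.card_map]; exact H.2.1 n k, fun k n n' h => by
    rw [Finset.disjoint_map]; exact H.2.2 k n n' h⟩

theorem Placement.mem_permute {N K L m : ℕ} (σ : IndexPerm K L) (H : Placement N K L m)
    (n : Fin N) (k : Fin K) (i : Fin L) : σ k i ∈ (H.permute σ).1 n k ↔ i ∈ H.1 n k := by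
  simp [Placement.permute]

theorem Placement.permute_mul {N K L m : ℕ} (σ τ : IndexPerm K L) (H : Placement N K L m) :
    H.permute (σ * τ) = (H.permute τ).permute σ := by
  apply Subtype.ext
  funext n k
  simp only [Placement.permute, Pi.mul_apply, Finset.map_map]
  rfl

theorem Placement.eq_of_mem {N K L m : ℕ} (H : Placement N K L m) {n n' : Fin N} {k : Fin K}
    {i : Fin L} (h : i ∈ H.1 n k) (h' : i ∈ H.1 n' k) : n = n' := by
  by_contra hne
  exact Finset.disjoint_left.1 (H.2.2 k n n' hne) h h'

/-- Two injective families of points are related by a permutation of the whole set. -/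
theorem exists_perm_extending {X α : Type} [Finite α] (a b : X → α) (ha : Function.Injective a)
    (hb : Function.Injective b) : ∃ σ : Equiv.Perm α, ∀ x, σ (a x) = b x := by
  classical
  let e : Set.range a ≃ Set.range b :=
    (Equiv.ofInjective a ha).symm.trans (Equiv.ofInjective b hb)
  have : Fintype α := Fintype.ofFinite α
  refine ⟨e.extendSubtype, fun x => ?_⟩
  rw [Equiv.extendSubtype_apply_of_mem _ _ ⟨x, rfl⟩]
  simp [e]

/-- Relabellings act transitively on placements. -/
theorem Placement.exists_permute_eq {N K L m : ℕ} (H H' : Placement N K L m) :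
    ∃ σ, H.permute σ = H' := by
  have key : ∀ k, ∃ σ : Equiv.Perm (Fin L), ∀ n i, i ∈ H.1 n k → σ i ∈ H'.1 n k := by
    intro k
    let e : ∀ n, H.1 n k ≃ H'.1 n k := fun n =>
      Finset.equivOfCardEq ((H.2.1 n k).trans (H'.2.1 n k).symm)
    obtain ⟨σ, hσ⟩ := exists_perm_extending (X := Σ n, H.1 n k) (fun x => (x.2 : Fin L))
      (fun x => (e x.1 x.2 : Fin L))
      (by
        rintro ⟨n, i, hi⟩ ⟨n', i', hi'⟩ (rfl : i = i')
        obtain rfl := H.eq_of_mem hi hi'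
        rfl)
      (by
        rintro ⟨n, i⟩ ⟨n', i'⟩ h
        dsimp only at h
        obtain rfl : n = n' := H'.eq_of_mem (Finset.coe_mem (e n i)) (h ▸ Finset.coe_mem (e n' i'))
        rw [Subtype.val_injective.eq_iff, EmbeddingLike.apply_eq_iff_eq] at h
        rw [h])
    refine ⟨σ, fun n i hi => ?_⟩
    rw [hσ ⟨n, i, hi⟩]
    exact Finset.coe_mem _
  choose σ hσ using key
  refine ⟨σ, Subtype.ext (funext fun n => funext fun k => ?_)⟩
  refine Finset.eq_of_subset_of_card_le ?_ ?_
  · intro i hi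
    simp only [Placement.permute, Finset.mem_map, Equiv.coe_toEmbedding] at hi
    obtain ⟨j, hj, rfl⟩ := hi
    exact hσ k n j hj
  · rw [H'.2.1, (H.permute σ).2.1]

/-! ### Queries for sums of bits -/

/-- The sums that are asked from one database: `d t` sums of type `S` for each set `S` of `t`
messages. -/
abbrev SumSlot (K : ℕ) (d : ℕ → ℕ) : Type := Σ S : Finset (Fin K), Fin (d S.card)

/-- A query to one database: a sum of type `S` consists of one bit of each message in `S`, and the
query names the index of this bit. -/
abbrev SumQuery (K L : ℕ) (d : ℕ → ℕ) : Type :=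
  (x : SumSlot K d) → {k // k ∈ x.1} → Fin L

/-- The relabelled query. -/
def permuteQuery {K L : ℕ} {d : ℕ → ℕ} (σ : IndexPerm K L) (q : SumQuery K L d) :
    SumQuery K L d :=
  fun x k => σ k.1 (q x k)

/-- The sums modulo 2 that a query asks for. -/
def sumAnswer {K L : ℕ} {d : ℕ → ℕ} (q : SumQuery K L d) (W : Messages K L) :
    SumSlot K d → ZMod 2 :=
  fun x => ∑ k : {k // k ∈ x.1}, if W k.1 (q x k) then 1 else 0

/-- No bit is used twice in the query to one database. -/
def SumQuery.NoRepeat {K L : ℕ} {d : ℕ → ℕ} (q : SumQuery K L d) : Prop :=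
  ∀ (k : Fin K) (x y : SumSlot K d) (hx : k ∈ x.1) (hy : k ∈ y.1),
    q x ⟨k, hx⟩ = q y ⟨k, hy⟩ → x = y

/-- The queries `q` retrieve the message `θ` with the help of the cache `H`: each sum with a bit
of `θ` in it asks for a new bit of `θ`, and the rest of this sum is known, either because it is
asked for as such from some database or because all of its bits are in the cache. -/
structure Retrieves {N K L m : ℕ} {d : ℕ → ℕ} (θ : Fin K) (H : Placement N K L m)
    (q : Fin N → SumQuery K L d) : Prop where
  uncached : ∀ n x (hx : θ ∈ x.1) n', q n x ⟨θ, hx⟩ ∉ H.1 n' θ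
  new : ∀ n x (hx : θ ∈ x.1) n' x' (hx' : θ ∈ x'.1),
    q n x ⟨θ, hx⟩ = q n' x' ⟨θ, hx'⟩ → (n, x) = (n', x')
  rest_known : ∀ n x, θ ∈ x.1 →
    (∃ n' x', ∃ hx' : x'.1 = x.1.erase θ, ∀ k (hk : k ∈ x'.1),
      q n x ⟨k, Finset.mem_of_mem_erase (hx' ▸ hk)⟩ = q n' x' ⟨k, hk⟩) ∨
    (∀ k (hk : k ∈ x.1), k ≠ θ → ∃ n', q n x ⟨k, hk⟩ ∈ H.1 n' k)

/-- Queries for all the messages `θ`, with the same base placement `H`, that can be made private by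
a random relabelling: no database sees a repeated bit or a bit that has been cached from it. -/
structure IsTemplate {N K L m : ℕ} {d : ℕ → ℕ} (H : Placement N K L m)
    (q : Fin K → Fin N → SumQuery K L d) : Prop where
  noRepeat : ∀ θ n, (q θ n).NoRepeat
  avoids : ∀ θ n x (k : Fin K) (hk : k ∈ x.1), q θ n x ⟨k, hk⟩ ∉ H.1 n k
  retrieves : ∀ θ, Retrieves θ H (q θ)

section

variable {N K L m : ℕ} {d : ℕ → ℕ}

theorem SumQuery.NoRepeat.permute {q : SumQuery K L d} (h : q.NoRepeat) (σ : IndexPerm K L) :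
    (permuteQuery σ q).NoRepeat := fun k x y hx hy hxy =>
  h k x y hx hy ((σ k).injective hxy)

theorem Retrieves.permute {θ : Fin K} {H : Placement N K L m} {q : Fin N → SumQuery K L d}
    (h : Retrieves θ H q) (σ : IndexPerm K L) :
    Retrieves θ (H.permute σ) (fun n => permuteQuery σ (q n)) where
  uncached n x hx n' := by
    rw [permuteQuery, Placement.mem_permute]
    exact h.uncached n x hx n'
  new n x hx n' x' hx' he := h.new n x hx n' x' hx' ((σ θ).injective he)
  rest_known n x hx := by
    rcases h.rest_known n x hx with ⟨n', x', he, hr⟩ | hr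
    · exact Or.inl ⟨n', x', he, fun k hk => congrArg (σ k) (hr k hk)⟩
    · refine Or.inr fun k hk hne => ?_
      obtain ⟨n', hn'⟩ := hr k hk hne
      exact ⟨n', (Placement.mem_permute σ H n' k _).2 hn'⟩

theorem permuteQuery_mul (σ τ : IndexPerm K L) (q : SumQuery K L d) :
    permuteQuery (σ * τ) q = permuteQuery σ (permuteQuery τ q) := rfl

/-- The answer to a query without repeated bits is uniform: changing, for each sum, one of its bits
changes the answer by an arbitrary vector. -/
theorem uniform_map_sumAnswer (hd : d 0 = 0) (q : SumQuery K L d) (hq : q.NoRepeat) :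
    (PMF.uniformOfFintype (Messages K L)).map (sumAnswer q) =
      PMF.uniformOfFintype (SumSlot K d → ZMod 2) := by
  classical
  have hne : ∀ x : SumSlot K d, x.1.Nonempty := by
    rintro ⟨S, j⟩
    rw [Finset.nonempty_iff_ne_empty]
    rintro rfl
    have := j.2
    simp [hd] at this
  choose lead hlead using hne
  -- the change of the messages that adds `c` to the answer
  let flip : (SumSlot K d → ZMod 2) → Messages K L := fun c k i =>
    decide (∃ x, ∃ h : lead x = k, q x ⟨k, h ▸ hlead x⟩ = i ∧ c x = 1)
  have hinv : ∀ c, Function.Involutive fun (W : Messages K L) k i => xor (W k i) (flip c k i) := by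
    intro c W
    funext k i
    simp
  refine uniform_map_of_translate _ (fun c => (hinv c).toPerm) fun c W => ?_
  funext x
  have hflip : ∀ k : {k // k ∈ x.1}, (if flip c k.1 (q x k) then (1 : ZMod 2) else 0) =
      if k = ⟨lead x, hlead x⟩ then c x else 0 := by
    rintro ⟨k, hk⟩
    have hiff : (∃ y, ∃ h : lead y = k, q y ⟨k, h ▸ hlead y⟩ = q x ⟨k, hk⟩ ∧ c y = 1) ↔
        lead x = k ∧ c x = 1 := by
      constructor
      · rintro ⟨y, hy, he, hc⟩
        obtain rfl := hq k y x _ hk he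
        exact ⟨hy, hc⟩
      · rintro ⟨hx, hc⟩
        exact ⟨x, hx, rfl, hc⟩
    have h01 : c x = 0 ∨ c x = 1 := by
      generalize c x = z
      revert z; decide
    simp only [flip, hiff, decide_eq_true_eq, Subtype.mk.injEq]
    rcases h01 with h | h <;> simp [h, eq_comm]
  have hxor : ∀ a b : Bool, (if xor a b then (1 : ZMod 2) else 0) =
      (if a then 1 else 0) + (if b then 1 else 0) := by decide
  calc sumAnswer q (fun k i => xor (W k i) (flip c k i)) x
      = ∑ k : {k // k ∈ x.1}, ((if W k.1 (q x k) then (1 : ZMod 2) else 0) +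
          if flip c k.1 (q x k) then (1 : ZMod 2) else 0) :=
        Finset.sum_congr rfl fun k _ => hxor _ _
    _ = sumAnswer q W x + c x := by
        rw [Finset.sum_add_distrib, Finset.sum_congr rfl fun k _ => hflip k,
          Finset.sum_ite_eq' Finset.univ, if_pos (Finset.mem_univ _)]
        rfl

/-- Messages that agree on the cached bits and lead to the same answers have the same bits of the
desired message `θ` wherever the queries ask for them. -/
theorem Retrieves.decode {θ : Fin K} {H : Placement N K L m} {q : Fin N → SumQuery K L d}
    (h : Retrieves θ H q) {W W' : Messages K L}
    (hcache : ∀ n k i, i ∈ H.1 n k → W k i = W' k i)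
    (hans : ∀ n, sumAnswer (q n) W = sumAnswer (q n) W') (n : Fin N) (x : SumSlot K d)
    (hx : θ ∈ x.1) : W θ (q n x ⟨θ, hx⟩) = W' θ (q n x ⟨θ, hx⟩) := by
  classical
  -- the sum over the other messages
  have split : ∀ V : Messages K L, sumAnswer (q n) V x =
      (if V θ (q n x ⟨θ, hx⟩) then (1 : ZMod 2) else 0) +
        ∑ k ∈ (Finset.univ : Finset {k // k ∈ x.1}).erase ⟨θ, hx⟩,
          (if V k.1 (q n x k) then (1 : ZMod 2) else 0) := fun V =>
    (Finset.add_sum_erase Finset.univ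
      (fun k : {k // k ∈ x.1} => if V k.1 (q n x k) then (1 : ZMod 2) else 0)
      (Finset.mem_univ (⟨θ, hx⟩ : {k // k ∈ x.1}))).symm
  have rest : ∑ k ∈ (Finset.univ : Finset {k // k ∈ x.1}).erase ⟨θ, hx⟩,
        (if W k.1 (q n x k) then (1 : ZMod 2) else 0) =
      ∑ k ∈ (Finset.univ : Finset {k // k ∈ x.1}).erase ⟨θ, hx⟩,
        (if W' k.1 (q n x k) then (1 : ZMod 2) else 0) := by
    rcases h.rest_known n x hx with ⟨n', x', he, hr⟩ | hr
    · have key : ∀ V : Messages K L,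
          ∑ k ∈ (Finset.univ : Finset {k // k ∈ x.1}).erase ⟨θ, hx⟩,
            (if V k.1 (q n x k) then (1 : ZMod 2) else 0) = sumAnswer (q n') V x' := by
        intro V
        have hmem : ∀ k : {k // k ∈ x'.1}, k.1 ∈ x.1.erase θ := fun k => he ▸ k.2
        symm
        refine Finset.sum_bij
          (fun k _ => ⟨k.1, Finset.mem_of_mem_erase (hmem k)⟩) ?_ ?_ ?_ ?_
        · rintro ⟨k, hk⟩ -
          have : k ≠ θ := Finset.ne_of_mem_erase (hmem ⟨k, hk⟩)
          simpa using this
        · rintro ⟨k, hk⟩ - ⟨l, hl⟩ - hkl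
          simpa using hkl
        · rintro ⟨k, hk⟩ hk'
          have : k ≠ θ := by simpa using hk'
          exact ⟨⟨k, by rw [he]; exact Finset.mem_erase.2 ⟨this, hk⟩⟩, Finset.mem_univ _, rfl⟩
        · rintro ⟨k, hk⟩ -
          rw [hr k hk]
      rw [key, key, hans]
    · refine Finset.sum_congr rfl ?_
      rintro ⟨k, hk⟩ hk'
      have : k ≠ θ := by simpa using hk'
      obtain ⟨n', hn'⟩ := hr k hk this
      rw [hcache n' k _ hn']
  have heq := congrFun (hans n) x
  rw [split W, split W', rest] at heq
  have h01 : ∀ a b : Bool, (if a then (1 : ZMod 2) else 0) = (if b then 1 else 0) → a = b := by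
    decide
  exact h01 _ _ (add_right_cancel heq)

/-- The set `U` of the bits of `θ` that a retrieving family of queries does not reveal. -/
theorem Retrieves.exists_unknown {θ : Fin K} {H : Placement N K L m}
    {q : Fin N → SumQuery K L d} (h : Retrieves θ H q) :
    ∃ U : Finset (Fin L),
      U.card + N * (m + Fintype.card {x : SumSlot K d // θ ∈ x.1}) = L ∧
      ∀ W W' : Messages K L, (∀ n k i, i ∈ H.1 n k → W k i = W' k i) →
        (∀ n, sumAnswer (q n) W = sumAnswer (q n) W') → ∀ i ∉ U, W θ i = W' θ i := by
  classical
  let C : Finset (Fin L) := Finset.univ.biUnion fun n => H.1 n θ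
  let f : Fin N × {x : SumSlot K d // θ ∈ x.1} → Fin L := fun y => q y.1 y.2.1 ⟨θ, y.2.2⟩
  have hf : Function.Injective f := by
    rintro ⟨n, x, hx⟩ ⟨n', x', hx'⟩ he
    have := h.new n x hx n' x' hx' he
    simp only [Prod.mk.injEq] at this
    obtain ⟨rfl, rfl⟩ := this
    rfl
  let A : Finset (Fin L) := Finset.univ.image f
  have hC : C.card = N * m := by
    rw [Finset.card_biUnion fun n _ n' _ hn => H.2.2 θ n n' hn]
    simp [H.2.1]
  have hA : A.card = N * Fintype.card {x : SumSlot K d // θ ∈ x.1} := by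
    rw [Finset.card_image_of_injective _ hf, Finset.card_univ, Fintype.card_prod, Fintype.card_fin]
  have hdis : Disjoint C A := by
    rw [Finset.disjoint_left]
    intro i hi hi'
    simp only [C, A, Finset.mem_biUnion, Finset.mem_univ, true_and, Finset.mem_image] at hi hi'
    obtain ⟨n', hn'⟩ := hi
    obtain ⟨⟨n, x, hx⟩, rfl⟩ := hi'
    exact h.uncached n x hx n' hn'
  refine ⟨(C ∪ A)ᶜ, ?_, ?_⟩
  · rw [mul_add, ← hC, ← hA, ← Finset.card_union_of_disjoint hdis, Finset.card_compl_add_card,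
      Fintype.card_fin]
  · intro W W' hcache hans i hi
    simp only [Finset.mem_compl, not_not, Finset.mem_union] at hi
    rcases hi with hi | hi
    · simp only [C, Finset.mem_biUnion, Finset.mem_univ, true_and] at hi
      obtain ⟨n, hn⟩ := hi
      exact hcache n θ i hn
    · simp only [A, Finset.mem_univ, true_and, Finset.mem_image] at hi
      obtain ⟨⟨n, x, hx⟩, rfl⟩ := hi
      exact h.decode hcache hans n x hx

/-! ### The scheme with randomly relabelled queries -/

/-- The relabellings that lead from one placement to another. -/
abbrev Relabelling (H₀ H : Placement N K L m) : Type := {σ : IndexPerm K L // H₀.permute σ = H}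

noncomputable instance (H₀ H : Placement N K L m) : Fintype (Relabelling H₀ H) := Fintype.ofFinite _

instance (H₀ H : Placement N K L m) : Nonempty (Relabelling H₀ H) :=
  let ⟨σ, hσ⟩ := H₀.exists_permute_eq H
  ⟨⟨σ, hσ⟩⟩

theorem Relabelling.card_eq (H₀ H H' : Placement N K L m) :
    Fintype.card (Relabelling H₀ H) = Fintype.card (Relabelling H₀ H') := by
  have le : ∀ H H' : Placement N K L m,
      Fintype.card (Relabelling H₀ H) ≤ Fintype.card (Relabelling H₀ H') := by
    intro H H'
    obtain ⟨τ, hτ⟩ := H.exists_permute_eq H'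
    refine Fintype.card_le_of_injective
      (fun σ => ⟨τ * σ.1, by rw [Placement.permute_mul, σ.2, hτ]⟩) ?_
    intro σ σ' h
    exact Subtype.ext (mul_left_cancel (congrArg Subtype.val h))
  exact le_antisymm (le H H') (le H' H)

/-- The scheme of a template: the user draws a uniformly random relabelling of the message bits
among those that lead from the base placement to the actual one, and asks the relabelled
queries. -/
noncomputable def templateScheme (hfits : N * m ≤ L) (H₀ : Placement N K L m)
    (q : Fin K → Fin N → SumQuery K L d) : Scheme N K L m where
  fits := hfits
  Query := SumQuery K L d
  Answer := SumSlot K d → ZMod 2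
  queryLaw θ H := (PMF.uniformOfFintype (Relabelling H₀ H)).map fun σ n => permuteQuery σ.1 (q θ n)
  answer _ Q W := sumAnswer Q W

variable (hfits : N * m ≤ L) (H₀ : Placement N K L m) (q : Fin K → Fin N → SumQuery K L d)

/-- The outcome with messages `W` that results from the relabelling `σ`. -/
def templateOutcome (θ : Fin K) (W : Messages K L) (σ : IndexPerm K L) :
    (templateScheme hfits H₀ q).Outcome :=
  (W, H₀.permute σ, fun n => permuteQuery σ (q θ n))

/-- Placement and queries together are the base placement and the template, relabelled by one
uniformly random relabelling. -/
theorem templateScheme_law (θ : Fin K) :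
    (templateScheme hfits H₀ q).law θ =
      (PMF.uniformOfFintype (Messages K L)).bind fun W =>
        (PMF.uniformOfFintype (IndexPerm K L)).map (templateOutcome hfits H₀ q θ W) := by
  have : Nonempty (Placement N K L m) := ⟨H₀⟩
  unfold Scheme.law
  congr 1
  funext W
  rw [← uniform_bind_uniform_fiber (fun σ : IndexPerm K L => H₀.permute σ)
    (Relabelling.card_eq H₀), PMF.map_bind]
  congr 1
  funext H
  refine (PMF.map_comp _ _ _).trans ?_
  rw [PMF.map_comp]
  congr 1
  funext σ
  simp only [Function.comp, templateOutcome, σ.2]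

variable {H₀ q}

/-- A database cannot distinguish the templates for two messages, because some relabelling maps
one to the other and preserves the indices cached from this database. -/
theorem IsTemplate.isPrivate (h : IsTemplate H₀ q) : (templateScheme hfits H₀ q).IsPrivate := by
  classical
  intro n θ θ'
  have key : ∀ k, ∃ τ : Equiv.Perm (Fin L), (∀ i ∈ H₀.1 n k, τ i = i) ∧
      ∀ x (hx : k ∈ x.1), τ (q θ n x ⟨k, hx⟩) = q θ' n x ⟨k, hx⟩ := by
    intro k
    have inj : ∀ η, Function.Injective
        (Sum.elim (fun i : H₀.1 n k => (i : Fin L))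
          (fun x : {x : SumSlot K d // k ∈ x.1} => q η n x.1 ⟨k, x.2⟩)) := by
      intro η
      refine Function.Injective.sumElim Subtype.val_injective ?_ ?_
      · rintro ⟨x, hx⟩ ⟨y, hy⟩ hxy
        exact Subtype.ext (h.noRepeat η n k x y hx hy hxy)
      · rintro ⟨i, hi⟩ ⟨x, hx⟩ (rfl : i = _)
        exact h.avoids η n x k hx hi
    obtain ⟨τ, hτ⟩ := exists_perm_extending _ _ (inj θ) (inj θ')
    exact ⟨τ, fun i hi => hτ (Sum.inl ⟨i, hi⟩), fun x hx => hτ (Sum.inr ⟨x, hx⟩)⟩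
  choose τ hτ hτq using key
  have e1 : permuteQuery τ (q θ n) = q θ' n := by
    funext x k
    exact hτq k.1 x k.2
  have e2 : (H₀.permute τ).1 n = H₀.1 n := by
    funext k
    refine Finset.eq_of_subset_of_card_le ?_ ?_
    · intro i hi
      simp only [Placement.permute, Finset.mem_map, Equiv.coe_toEmbedding] at hi
      obtain ⟨j, hj, rfl⟩ := hi
      rwa [hτ k j hj]
    · rw [(H₀.permute τ).2.1, H₀.2.1]
  have e3 : ∀ σ : IndexPerm K L, (H₀.permute (σ * τ)).1 n = (H₀.permute σ).1 n := by
    intro σ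
    rw [Placement.permute_mul]
    funext k
    simp only [Placement.permute] at e2 ⊢
    rw [congrFun e2 k]
  rw [templateScheme_law, templateScheme_law, PMF.map_bind, PMF.map_bind]
  congr 1
  funext W
  rw [PMF.map_comp, PMF.map_comp]
  conv_lhs => rw [← uniform_map_equiv (Equiv.mulRight τ), PMF.map_comp]
  congr 1
  funext σ
  have e4 : permuteQuery (σ * τ) (q θ n) = permuteQuery σ (q θ' n) := by
    rw [permuteQuery_mul, e1]
  change (permuteQuery (σ * τ) (q θ n), sumAnswer (permuteQuery (σ * τ) (q θ n)) W, W,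
    (H₀.permute (σ * τ)).1 n) = (permuteQuery σ (q θ' n), sumAnswer (permuteQuery σ (q θ' n)) W, W,
    (H₀.permute σ).1 n)
  rw [e3, e4]

/-- Each answer is uniform for every relabelling, hence has as many bits of entropy as it has
sums. -/
theorem IsTemplate.downloadCost_eq (h : IsTemplate H₀ q) (hd : d 0 = 0) (θ : Fin K) :
    (templateScheme hfits H₀ q).downloadCost θ = N * Fintype.card (SumSlot K d) := by
  have key : ∀ n, ((templateScheme hfits H₀ q).law θ).map ((templateScheme hfits H₀ q).ans n) =
      PMF.uniformOfFintype (SumSlot K d → ZMod 2) := by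
    intro n
    rw [templateScheme_law, PMF.map_bind]
    simp only [PMF.map_comp]
    simp only [← PMF.bind_pure_comp, Function.comp_def]
    rw [PMF.bind_comm]
    have : ∀ σ : IndexPerm K L, ((PMF.uniformOfFintype (Messages K L)).bind fun W =>
        PMF.pure ((templateScheme hfits H₀ q).ans n
          (templateOutcome hfits H₀ q θ W σ))) =
        PMF.uniformOfFintype (SumSlot K d → ZMod 2) := fun σ =>
      uniform_map_sumAnswer hd _ ((h.noRepeat θ n).permute σ)
    simp only [this]
    exact PMF.bind_const _ _
  have e : ∀ n, entropy (((templateScheme hfits H₀ q).law θ).map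
      ((templateScheme hfits H₀ q).ans n)) = Fintype.card (SumSlot K d) := by
    intro n
    rw [key]
    refine (entropy_uniformOfFintype (SumSlot K d → ZMod 2)).trans ?_
    have : Real.log 2 ≠ 0 := (Real.log_pos one_lt_two).ne'
    rw [Fintype.card_fun, ZMod.card]
    push_cast
    rw [Real.log_pow, mul_div_cancel_right₀ _ this]
  rw [Scheme.downloadCost, Finset.sum_congr rfl fun n _ => e n]
  simp

/-- Given all that the user knows, the desired message is determined by its bits that are neither
cached nor contained in a downloaded sum. -/
theorem IsTemplate.equivocation_le (h : IsTemplate H₀ q) (θ : Fin K) :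
    (templateScheme hfits H₀ q).equivocation θ ≤
      L - N * (m + Fintype.card {x : SumSlot K d // θ ∈ x.1}) := by
  classical
  obtain ⟨U₀, hU₀, -⟩ := (h.retrieves θ).exists_unknown
  have hlog : Real.log ((2 ^ U₀.card : ℕ) : ℝ) / Real.log 2 =
      L - N * (m + Fintype.card {x : SumSlot K d // θ ∈ x.1}) := by
    have : Real.log 2 ≠ 0 := (Real.log_pos one_lt_two).ne'
    push_cast
    rw [Real.log_pow, mul_div_cancel_right₀ _ this, eq_sub_iff_add_eq]
    exact_mod_cast hU₀
  rw [← hlog]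
  refine condEntropy_le _ _ _ _ (by positivity) fun y => ?_
  rcases Set.eq_empty_or_nonempty {x | ∃ ω ∈ ((templateScheme hfits H₀ q).law θ).support,
      ω.1 θ = x ∧ ((templateScheme hfits H₀ q).cache ω, ω.2.1, ω.2.2,
        fun n => (templateScheme hfits H₀ q).ans n ω) = y} with he | ⟨x₀, ω₀, hω₀, hx₀, hy₀⟩
  · rw [he]; simp
  have hret : Retrieves θ ω₀.2.1 ω₀.2.2 := by
    rw [templateScheme_law] at hω₀
    obtain ⟨W, -, hW⟩ := (PMF.mem_support_bind_iff _ _ _).1 hω₀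
    rw [PMF.support_map] at hW
    obtain ⟨σ, -, rfl⟩ := hW
    exact (h.retrieves θ).permute σ
  obtain ⟨U, hU, hdec⟩ := hret.exists_unknown
  have hUc : U.card = U₀.card := by omega
  have hsub : ∀ x, (∃ ω ∈ ((templateScheme hfits H₀ q).law θ).support,
      ω.1 θ = x ∧ ((templateScheme hfits H₀ q).cache ω, ω.2.1, ω.2.2,
        fun n => (templateScheme hfits H₀ q).ans n ω) = y) → ∀ i ∉ U, x i = x₀ i := by
    rintro x ⟨ω, -, rfl, hy⟩ i hi
    rw [← hx₀]
    rw [← hy₀] at hy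
    simp only [Prod.mk.injEq] at hy
    obtain ⟨hc, hH, hQ, hA⟩ := hy
    refine hdec ω.1 ω₀.1 ?_ ?_ i hi
    · intro n k i hik
      have := congrFun (congrFun (congrFun hc n) k) i
      have hik' : i ∈ ω.2.1.1 n k := by rw [hH]; exact hik
      simpa [Scheme.cache, hik, hik'] using this
    · intro n
      have hAn : sumAnswer (ω.2.2 n) ω.1 = sumAnswer (ω₀.2.2 n) ω₀.1 := congrFun hA n
      rwa [congrFun hQ n] at hAn
  -- a compatible value of the message is determined by its bits in `U`
  have hinj : Set.InjOn (fun (x : Fin L → Bool) (i : U) => x i)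
      {x | ∃ ω ∈ ((templateScheme hfits H₀ q).law θ).support,
        ω.1 θ = x ∧ ((templateScheme hfits H₀ q).cache ω, ω.2.1, ω.2.2,
          fun n => (templateScheme hfits H₀ q).ans n ω) = y} := by
    intro x hx x' hx' hxx'
    funext i
    by_cases hi : i ∈ U
    · exact congrFun hxx' ⟨i, hi⟩
    · rw [hsub x hx i hi, hsub x' hx' i hi]
  rw [← hinj.ncard_image, ← hUc]
  refine (Set.ncard_le_card _).trans ?_
  simp
end

/-! ### Counting sums -/

theorem card_sumSlot (K : ℕ) (d : ℕ → ℕ) :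
    Fintype.card (SumSlot K d) = ∑ t ∈ Finset.range (K + 1), K.choose t * d t := by
  rw [Fintype.card_sigma]
  simp only [Fintype.card_fin]
  rw [← Finset.powerset_univ, Finset.sum_powerset_apply_card, Finset.card_univ, Fintype.card_fin]
  simp only [smul_eq_mul]

/-- The number of the sums that contain `k` and otherwise only messages in `R`. -/
theorem card_sumSlot_of_mem {K : ℕ} (d : ℕ → ℕ) (k : Fin K) (R : Finset (Fin K)) (hk : k ∉ R)
    (P : Finset (Fin K) → Prop) (hP : ∀ S, P S ↔ k ∈ S ∧ S.erase k ⊆ R)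
    [Fintype {x : SumSlot K d // P x.1}] :
    Fintype.card {x : SumSlot K d // P x.1} =
      ∑ i ∈ Finset.range (R.card + 1), R.card.choose i * d (i + 1) := by
  classical
  have e : {x : SumSlot K d // P x.1} ≃ Σ S : {S // P S}, Fin (d S.1.card) :=
    { toFun := fun x => ⟨⟨x.1.1, x.2⟩, x.1.2⟩
      invFun := fun x => ⟨⟨x.1.1, x.2⟩, x.1.2⟩
      left_inv := fun _ => rfl
      right_inv := fun _ => rfl }
  rw [Fintype.card_congr e, Fintype.card_sigma]
  simp only [Fintype.card_fin]
  have h : ∑ T ∈ R.powerset, d (T.card + 1) =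
      ∑ i ∈ Finset.range (R.card + 1), R.card.choose i * d (i + 1) := by
    rw [Finset.sum_powerset_apply_card fun i => d (i + 1)]
    simp only [smul_eq_mul]
  rw [← h]
  refine Finset.sum_bij (fun S _ => S.1.erase k) ?_ ?_ ?_ ?_
  · rintro ⟨S, hS⟩ -
    exact Finset.mem_powerset.2 ((hP S).1 hS).2
  · rintro ⟨S, hS⟩ - ⟨S', hS'⟩ - he
    apply Subtype.ext
    calc S = insert k (S.erase k) := (Finset.insert_erase ((hP S).1 hS).1).symm
      _ = insert k (S'.erase k) := congrArg (insert k) he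
      _ = S' := Finset.insert_erase ((hP S').1 hS').1
  · intro T hT
    have hT' := Finset.mem_powerset.1 hT
    have hkT : k ∉ T := fun h => hk (hT' h)
    refine ⟨⟨insert k T, (hP _).2 ⟨Finset.mem_insert_self k T, ?_⟩⟩, Finset.mem_univ _, ?_⟩
    · rwa [Finset.erase_insert hkT]
    · exact Finset.erase_insert hkT
  · rintro ⟨S, hS⟩ -
    rw [Finset.card_erase_add_one ((hP S).1 hS).1]

/-- The number of the sums from one database that contain a given message. -/
theorem card_sumSlot_mem {K : ℕ} (d : ℕ → ℕ) (k : Fin K) :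
    Fintype.card {x : SumSlot K d // k ∈ x.1} =
      ∑ i ∈ Finset.range K, (K - 1).choose i * d (i + 1) := by
  have hK : K - 1 + 1 = K := Nat.succ_pred_eq_of_pos k.pos
  have := card_sumSlot_of_mem d k (Finset.univ.erase k) (by simp) (fun S => k ∈ S)
    fun S => ⟨fun h => ⟨h, Finset.erase_subset_erase _ (Finset.subset_univ S)⟩, fun h => h.1⟩
  rwa [Finset.card_erase_of_mem (Finset.mem_univ k), Finset.card_univ, Fintype.card_fin, hK]
    at this

/-- The number of the sums that contain `k` and do not contain `θ`. -/
theorem card_sumSlot_mem_notMem {K : ℕ} (c : ℕ → ℕ) (k θ : Fin K) (hne : k ≠ θ) :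
    Fintype.card {y : SumSlot K c // k ∈ y.1 ∧ θ ∉ y.1} =
      ∑ i ∈ Finset.range (K - 1), (K - 2).choose i * c (i + 1) := by
  have hK : K - 2 + 1 = K - 1 := by
    have := k.2; have := θ.2
    have : k.1 ≠ θ.1 := fun h => hne (Fin.ext h)
    omega
  have := card_sumSlot_of_mem c k ((Finset.univ.erase k).erase θ) (by simp)
    (fun S => k ∈ S ∧ θ ∉ S) fun S => by
      refine and_congr_right fun _ => ⟨fun h i hi => ?_, fun h hθ => ?_⟩
      · simp only [Finset.mem_erase, Finset.mem_univ, and_true] at hi ⊢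
        exact ⟨fun he => h (he ▸ hi.2), hi.1⟩
      · exact (Finset.mem_erase.1 (h (Finset.mem_erase.2 ⟨hne.symm, hθ⟩))).1 rfl
  rwa [Finset.card_erase_of_mem (by simp [hne.symm]), Finset.card_erase_of_mem (Finset.mem_univ k),
    Finset.card_univ, Fintype.card_fin, Nat.sub_sub, hK] at this

/-! ### Side information and templates -/

section

variable {N K L m : ℕ} {c d : ℕ → ℕ}

/-- The set of messages that enter a downloaded or a cached sum. -/
def sumType : SumSlot K d ⊕ SumSlot K c → Finset (Fin K) := Sum.elim Sigma.fst Sigma.fst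

/-- Assignment of side information. A sum asked from database `n` that contains the desired message
`θ` gets a sum of the remaining messages that is downloaded or cached from another database, and
no two sums get the same one. The sums without `θ` keep their own bits. -/
theorem exists_sideInformation (hd : ∀ t, 1 ≤ t → d (t + 1) ≤ (N - 1) * (c t + d t)) (θ : Fin K)
    (n : Fin N) :
    ∃ P : {x : SumSlot K d // x.1 ≠ {θ}} → Fin N × (SumSlot K d ⊕ SumSlot K c),
      Function.Injective P ∧ (∀ x, sumType (P x).2 = x.1.1.erase θ) ∧
      (∀ x, θ ∈ x.1.1 → (P x).1 ≠ n) ∧ (∀ x, θ ∉ x.1.1 → P x = (n, Sum.inl x.1)) := by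
  classical
  have emb : ∀ S : Finset (Fin K), θ ∈ S → S ≠ {θ} → Nonempty (Fin (d S.card) ↪
      {n' // n' ≠ n} × (Fin (d (S.erase θ).card) ⊕ Fin (c (S.erase θ).card))) := by
    intro S hS hne
    apply Function.Embedding.nonempty_of_card_le
    have hpos : 1 ≤ (S.erase θ).card := by
      rw [Nat.one_le_iff_ne_zero, Finset.card_ne_zero, Finset.nonempty_iff_ne_empty]
      intro h
      rw [Finset.erase_eq_empty_iff] at h
      rcases h with h | h
      · simp [h] at hS
      · exact hne h
    have := hd _ hpos
    rw [Finset.card_erase_add_one hS] at this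
    simpa [Fintype.card_subtype_compl, add_comm] using this
  let ι := fun S h h' => (emb S h h').some
  let incl : (T : Finset (Fin K)) → Fin (d T.card) ⊕ Fin (c T.card) →
      SumSlot K d ⊕ SumSlot K c := fun T =>
    Sum.map (fun i => ⟨T, i⟩) (fun i => ⟨T, i⟩)
  have hincl : ∀ T, Function.Injective (incl T) := fun T =>
    Function.Injective.sumMap (fun i j h => by simpa using h) (fun i j h => by simpa using h)
  have htype : ∀ T z, sumType (incl T z) = T := by
    rintro T (z | z) <;> rfl
  let P : {x : SumSlot K d // x.1 ≠ {θ}} → Fin N × (SumSlot K d ⊕ SumSlot K c) := fun x =>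
    if h : θ ∈ x.1.1 then
      ((ι x.1.1 h x.2 x.1.2).1, incl (x.1.1.erase θ) (ι x.1.1 h x.2 x.1.2).2)
    else (n, Sum.inl x.1)
  have hP1 : ∀ x (h : θ ∈ x.1.1), P x =
      (((ι x.1.1 h x.2 x.1.2).1 : Fin N), incl (x.1.1.erase θ) (ι x.1.1 h x.2 x.1.2).2) :=
    fun x h => dif_pos h
  have hP2 : ∀ x, θ ∉ x.1.1 → P x = (n, Sum.inl x.1) := fun x h => dif_neg h
  have hP3 : ∀ x, θ ∈ x.1.1 → (P x).1 ≠ n := by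
    intro x h
    rw [hP1 x h]
    exact (ι x.1.1 h x.2 x.1.2).1.2
  have hP4 : ∀ x, sumType (P x).2 = x.1.1.erase θ := by
    intro x
    by_cases h : θ ∈ x.1.1
    · rw [hP1 x h, htype]
    · rw [hP2 x h, Finset.erase_eq_of_notMem h]
      rfl
  refine ⟨P, ?_, hP4, hP3, hP2⟩
  intro x y hxy
  by_cases hx : θ ∈ x.1.1 <;> by_cases hy : θ ∈ y.1.1
  · have hS : x.1.1 = y.1.1 := by
      rw [← Finset.insert_erase hx, ← Finset.insert_erase hy, ← hP4 x, ← hP4 y, hxy]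
    obtain ⟨⟨S, i⟩, hi⟩ := x
    obtain ⟨⟨S', j⟩, hj⟩ := y
    obtain rfl : S = S' := hS
    rw [hP1 _ hx, hP1 _ hy, Prod.mk.injEq, Subtype.val_injective.eq_iff,
      (hincl _).eq_iff, ← Prod.ext_iff, EmbeddingLike.apply_eq_iff_eq] at hxy
    simpa using hxy
  · exact absurd (by rw [hxy, hP2 y hy]) (hP3 x hx)
  · exact absurd (by rw [← hxy, hP2 x hx]) (hP3 y hy)
  · rw [hP2 x hx, hP2 y hy] at hxy
    exact Subtype.ext (Sum.inl_injective (congrArg Prod.snd hxy))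

/-- A template exists as soon as the side information suffices (`hd`), the cached sums fit into the
cache (`hc`) and the sums containing a message fit into its uncached part (`hL`). -/
theorem exists_isTemplate (hd : ∀ t, 1 ≤ t → d (t + 1) ≤ (N - 1) * (c t + d t))
    (hc : ∑ i ∈ Finset.range (K - 1), (K - 2).choose i * c (i + 1) ≤ m)
    (hL : N * (m + ∑ i ∈ Finset.range K, (K - 1).choose i * d (i + 1)) ≤ L)
    (H : Placement N K L m) : ∃ q : Fin K → Fin N → SumQuery K L d, IsTemplate H q := by
  classical
  -- the uncached bits of the downloaded sums, different for different databases
  have fresh : ∀ k : Fin K, ∃ f : Fin N → (x : SumSlot K d) → k ∈ x.1 → Fin L,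
      (∀ n x hx n', f n x hx ∉ H.1 n' k) ∧
      ∀ n x hx n' x' hx', f n x hx = f n' x' hx' → n = n' ∧ x = x' := by
    intro k
    let C : Finset (Fin L) := Finset.univ.biUnion fun n => H.1 n k
    have hC : C.card = N * m := by
      rw [Finset.card_biUnion fun n _ n' _ hn => H.2.2 k n n' hn]
      simp [H.2.1]
    have : Nonempty (Fin N × {x : SumSlot K d // k ∈ x.1} ↪ (Cᶜ : Finset (Fin L))) := by
      apply Function.Embedding.nonempty_of_card_le
      rw [Fintype.card_prod, Fintype.card_fin, card_sumSlot_mem, Fintype.card_coe,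
        Finset.card_compl, Fintype.card_fin, hC]
      rw [mul_add] at hL
      omega
    obtain ⟨f⟩ := this
    refine ⟨fun n x hx => f (n, ⟨x, hx⟩), ?_, ?_⟩
    · intro n x hx n' hmem
      have := (f (n, ⟨x, hx⟩)).2
      rw [Finset.mem_compl] at this
      exact this (Finset.mem_biUnion.2 ⟨n', Finset.mem_univ _, hmem⟩)
    · intro n x hx n' x' hx' he
      have := f.injective (Subtype.val_injective he)
      simpa using this
  choose fresh fresh_notMem fresh_inj using fresh
  -- the cached bits of the cached sums
  have side : ∀ (θ k : Fin K), k ≠ θ → ∀ n, ∃ f : (y : SumSlot K c) → k ∈ y.1 → θ ∉ y.1 → Fin L,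
      (∀ y hk hθ, f y hk hθ ∈ H.1 n k) ∧
      ∀ y hk hθ y' hk' hθ', f y hk hθ = f y' hk' hθ' → y = y' := by
    intro θ k hne n
    have : Nonempty ({y : SumSlot K c // k ∈ y.1 ∧ θ ∉ y.1} ↪ H.1 n k) := by
      apply Function.Embedding.nonempty_of_card_le
      rwa [card_sumSlot_mem_notMem c k θ hne, Fintype.card_coe, H.2.1]
    obtain ⟨f⟩ := this
    refine ⟨fun y hk hθ => f ⟨y, hk, hθ⟩, fun y hk hθ => (f ⟨y, hk, hθ⟩).2, ?_⟩
    intro y hk hθ y' hk' hθ' he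
    have := f.injective (Subtype.val_injective he)
    simpa using this
  choose side side_mem side_inj using side
  choose P P_inj P_type P_ne P_self using fun (θ : Fin K) (n : Fin N) =>
    exists_sideInformation (N := N) hd θ n
  -- the bit of message `k` in a sum without `θ` that is downloaded or cached from database `n`
  let val : (θ k : Fin K) → k ≠ θ → Fin N → (z : SumSlot K d ⊕ SumSlot K c) → k ∈ sumType z →
      θ ∉ sumType z → Fin L := fun θ k hne n z => match z with
    | Sum.inl x => fun hk _ => fresh k n x hk
    | Sum.inr y => fun hk hθ => side θ k hne n y hk hθ
  have val_inj : ∀ θ k hne n z hk hθ n' z' hk' hθ',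
      val θ k hne n z hk hθ = val θ k hne n' z' hk' hθ' → n = n' ∧ z = z' := by
    intro θ k hne n z hk hθ n' z' hk' hθ' he
    rcases z with x | y <;> rcases z' with x' | y'
    · obtain ⟨h1, h2⟩ := fresh_inj k n x hk n' x' hk' he
      exact ⟨h1, congrArg _ h2⟩
    · exact absurd (show fresh k n x hk ∈ H.1 n' k by
        rw [show fresh k n x hk = _ from he]
        exact side_mem θ k hne n' y' hk' hθ') (fresh_notMem k n x hk n')
    · exact absurd (show fresh k n' x' hk' ∈ H.1 n k by
        rw [show fresh k n' x' hk' = _ from he.symm]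
        exact side_mem θ k hne n y hk hθ) (fresh_notMem k n' x' hk' n)
    · obtain rfl : n = n' := H.eq_of_mem (side_mem θ k hne n y hk hθ)
        (by rw [show side θ k hne n y hk hθ = _ from he]; exact side_mem θ k hne n' y' hk' hθ')
      exact ⟨rfl, congrArg _ (side_inj θ k hne n y hk hθ y' hk' hθ' he)⟩
  have hmem : ∀ θ n x (k : Fin K), k ∈ x.1.1 → k ≠ θ → k ∈ sumType (P θ n x).2 := by
    intro θ n x k hk hne
    rw [P_type]
    exact Finset.mem_erase.2 ⟨hne, hk⟩
  have hnot : ∀ θ n x, θ ∉ sumType (P θ n x).2 := by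
    intro θ n x
    rw [P_type]
    exact Finset.notMem_erase _ _
  have hsingle : ∀ {θ k : Fin K} {x : SumSlot K d}, k ∈ x.1 → k ≠ θ → x.1 ≠ {θ} := by
    intro θ k x hk hne he
    rw [he, Finset.mem_singleton] at hk
    exact hne hk
  let q : Fin K → Fin N → SumQuery K L d := fun θ n x k =>
    if h : k.1 = θ then fresh k.1 n x k.2
    else val θ k.1 h (P θ n ⟨x, hsingle k.2 h⟩).1 (P θ n ⟨x, hsingle k.2 h⟩).2
      (hmem θ n _ k.1 k.2 h) (hnot θ n _)
  have q_self : ∀ θ n x (hx : θ ∈ x.1), q θ n x ⟨θ, hx⟩ = fresh θ n x hx := fun θ n x hx =>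
    dif_pos rfl
  have q_ne : ∀ θ n x k (hk : k ∈ x.1) (h : k ≠ θ), q θ n x ⟨k, hk⟩ =
      val θ k h (P θ n ⟨x, hsingle hk h⟩).1 (P θ n ⟨x, hsingle hk h⟩).2
        (hmem θ n _ k hk h) (hnot θ n _) := fun θ n x k hk h => dif_neg h
  have q_eq : ∀ θ n x k (hk : k ∈ x.1) (h : k ≠ θ) n' z (h1 : k ∈ sumType z) (h2 : θ ∉ sumType z),
      P θ n ⟨x, hsingle hk h⟩ = (n', z) → q θ n x ⟨k, hk⟩ = val θ k h n' z h1 h2 := by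
    intro θ n x k hk h n' z h1 h2 hz
    rw [q_ne θ n x k hk h]
    congr 1 <;> rw [hz]
  refine ⟨q, ?_, ?_, fun θ => ⟨?_, ?_, ?_⟩⟩
  · intro θ n k x y hx hy he
    by_cases h : k = θ
    · subst h
      rw [q_self, q_self] at he
      exact (fresh_inj k n x hx n y hy he).2
    · rw [q_ne θ n x k hx h, q_ne θ n y k hy h] at he
      have := val_inj _ _ _ _ _ _ _ _ _ _ _ he
      simpa using P_inj θ n (Prod.ext this.1 this.2)
  · intro θ n x k hk hbad
    by_cases h : k = θ
    · subst h
      rw [q_self] at hbad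
      exact fresh_notMem k n x hk n hbad
    · rw [q_ne θ n x k hk h] at hbad
      have hne := P_ne θ n ⟨x, hsingle hk h⟩
      have hself := P_self θ n ⟨x, hsingle hk h⟩
      generalize_proofs h1 h2 h3 at hbad hne hself
      revert h2 h3
      generalize P θ n ⟨x, h1⟩ = p at hne hself
      intro h2 h3 hbad
      obtain ⟨n', y | y⟩ := p
      · exact fresh_notMem k n' y h2 n hbad
      · by_cases hθ : θ ∈ x.1
        · exact hne hθ (H.eq_of_mem (side_mem θ k h n' y h2 h3) hbad)
        · simpa using hself hθ
  · intro n x hx n'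
    rw [q_self]
    exact fresh_notMem θ n x hx n'
  · intro n x hx n' x' hx' he
    rw [q_self, q_self] at he
    obtain ⟨rfl, rfl⟩ := fresh_inj θ n x hx n' x' hx' he
    rfl
  · intro n x hθ
    by_cases hS : x.1 = {θ}
    · refine Or.inr fun k hk hne => absurd ?_ hne
      rw [hS, Finset.mem_singleton] at hk
      exact hk
    · obtain ⟨n', z, hz⟩ : ∃ n' z, P θ n ⟨x, hS⟩ = (n', z) := ⟨_, _, rfl⟩
      have htype : sumType z = x.1.erase θ := by
        rw [← P_type θ n ⟨x, hS⟩, hz]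
      have hθz : θ ∉ sumType z := by
        rw [htype]; exact Finset.notMem_erase _ _
      rcases z with y | y
      · refine Or.inl ⟨n', y, htype, fun k hk => ?_⟩
        have hne : k ≠ θ := fun h => hθz (h ▸ hk)
        rw [q_eq θ n x k _ hne n' (Sum.inl y) hk hθz hz,
          q_eq θ n' y k hk hne n' (Sum.inl y) hk hθz (P_self θ n' ⟨y, hsingle hk hne⟩ hθz)]
      · refine Or.inr fun k hk hne => ⟨n', ?_⟩
        have hk' : k ∈ y.1 := by
          have : k ∈ x.1.erase θ := Finset.mem_erase.2 ⟨hne, hk⟩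
          rwa [← htype] at this
        rw [q_eq θ n x k hk hne n' (Sum.inr y) hk' hθz hz]
        exact side_mem θ k hne n' y hk' hθz

/-- The schemes, with their costs. -/
theorem exists_scheme (hd₀ : d 0 = 0) (hd : ∀ t, 1 ≤ t → d (t + 1) ≤ (N - 1) * (c t + d t))
    (hc : ∑ i ∈ Finset.range (K - 1), (K - 2).choose i * c (i + 1) ≤ m)
    (hL : N * (m + ∑ i ∈ Finset.range K, (K - 1).choose i * d (i + 1)) ≤ L) :
    ∃ S : Scheme N K L m, S.IsPrivate ∧
      (∀ θ, S.equivocation θ ≤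
        L - N * (m + (∑ i ∈ Finset.range K, (K - 1).choose i * d (i + 1) : ℕ))) ∧
      ∀ θ, S.downloadCost θ =
        N * (∑ t ∈ Finset.range (K + 1), K.choose t * d t : ℕ) := by
  have hfits : N * m ≤ L := (Nat.mul_le_mul_left N (Nat.le_add_right _ _)).trans hL
  obtain ⟨H⟩ := Placement.nonempty (K := K) hfits
  obtain ⟨q, hq⟩ := exists_isTemplate hd hc hL H
  refine ⟨templateScheme hfits H q, hq.isPrivate hfits, fun θ => ?_, fun θ => ?_⟩
  · have := hq.equivocation_le hfits θ
    rwa [card_sumSlot_mem] at this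
  · rw [hq.downloadCost_eq hfits hd₀ θ, card_sumSlot]

end

/-! ### Schemes for given proportions of sums -/

/-- The number of downloaded sums of each type that can be asked from one database, given the
numbers `c` of cached sums and the number `e` of plain bits of each message. -/
def sumCount (N : ℕ) (c : ℕ → ℕ) (e : ℕ) : ℕ → ℕ
  | 0 => 0
  | 1 => e
  | t + 2 => (N - 1) * (c (t + 1) + sumCount N c e (t + 1))

/-- Asymptotic proportions of the sums: per message bit, `γ t` cached and `δ t` downloaded sums
for each database and each set of `t` messages. The cached sums fit into the cache of ratio `r`, the
desired bits in the downloaded sums make up the uncached part of a message, and the download cost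
is `x`. -/
structure IsFeasibleWith (N K : ℕ) (r x : ℝ) (γ δ : ℕ → ℝ) : Prop where
  nonneg : ∀ t, 0 ≤ γ t
  zero : δ 0 = 0
  one : 0 ≤ δ 1
  succ : ∀ t, 1 ≤ t → δ (t + 1) = ((N : ℝ) - 1) * (γ t + δ t)
  cached : ∑ i ∈ Finset.range (K - 1), ((K - 2).choose i : ℝ) * γ (i + 1) ≤ r / N
  desired : r + N * ∑ i ∈ Finset.range K, ((K - 1).choose i : ℝ) * δ (i + 1) = 1
  cost : N * ∑ t ∈ Finset.range (K + 1), (K.choose t : ℝ) * δ t = x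

theorem IsFeasibleWith.convexComb {N K : ℕ} {r x r' x' : ℝ} {γ δ γ' δ' : ℕ → ℝ}
    (h : IsFeasibleWith N K r x γ δ) (h' : IsFeasibleWith N K r' x' γ' δ') {a b : ℝ}
    (ha : 0 ≤ a) (hb : 0 ≤ b) (hab : a + b = 1) :
    IsFeasibleWith N K (a * r + b * r') (a * x + b * x') (fun t => a * γ t + b * γ' t)
      (fun t => a * δ t + b * δ' t) where
  nonneg t := by have := h.nonneg t; have := h'.nonneg t; positivity
  zero := by rw [h.zero, h'.zero]; ring
  one := by have := h.one; have := h'.one; positivity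
  succ t ht := by rw [h.succ t ht, h'.succ t ht]; ring
  cached := by
    have h1 := mul_le_mul_of_nonneg_left h.cached ha
    have h2 := mul_le_mul_of_nonneg_left h'.cached hb
    simp only [mul_add, Finset.sum_add_distrib, mul_left_comm _ a, mul_left_comm _ b,
      ← Finset.mul_sum]
    rw [add_div, mul_div_assoc, mul_div_assoc]
    exact add_le_add h1 h2
  desired := by
    simp only [mul_add, Finset.sum_add_distrib, mul_left_comm _ a, mul_left_comm _ b,
      ← Finset.mul_sum]
    linear_combination a * h.desired + b * h'.desired + hab
  cost := by
    simp only [mul_add, Finset.sum_add_distrib, mul_left_comm _ a, mul_left_comm _ b,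
      ← Finset.mul_sum]
    linear_combination a * h.cost + b * h'.cost

theorem tendsto_floor_mul_div {a : ℝ} (ha : 0 ≤ a) :
    Tendsto (fun j : ℕ => (⌊a * j⌋₊ : ℝ) / j) atTop (𝓝 a) :=
  (tendsto_nat_floor_mul_div_atTop ha).comp tendsto_natCast_atTop_atTop

/-- Feasible proportions are achieved by messages of `j` bits with all counts rounded down, for
`j → ∞`. -/
theorem IsFeasibleWith.isAchievable {N K : ℕ} (hN : 1 ≤ N) {r x : ℝ} {γ δ : ℕ → ℝ}
    (h : IsFeasibleWith N K r x γ δ) : IsAchievable N K r x := by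
  have hN0 : (0 : ℝ) < N := by exact_mod_cast hN
  have hN1 : ((N - 1 : ℕ) : ℝ) = (N : ℝ) - 1 := by rw [Nat.cast_sub hN, Nat.cast_one]
  have hr : 0 ≤ r / N := le_trans (Finset.sum_nonneg fun i _ =>
    mul_nonneg (Nat.cast_nonneg _) (h.nonneg _)) h.cached
  let c : ℕ → ℕ → ℕ := fun j t => ⌊γ t * j⌋₊
  let d : ℕ → ℕ → ℕ := fun j => sumCount N (c j) ⌊δ 1 * j⌋₊
  have c_le : ∀ j t, (c j t : ℝ) ≤ γ t * j := fun j t =>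
    Nat.floor_le (mul_nonneg (h.nonneg t) (Nat.cast_nonneg j))
  have d_succ : ∀ j t, d j (t + 2) = (N - 1) * (c j (t + 1) + d j (t + 1)) := fun j t => rfl
  have d_le : ∀ j t, (d j (t + 1) : ℝ) ≤ δ (t + 1) * j := by
    intro j t
    induction t with
    | zero => exact Nat.floor_le (mul_nonneg h.one (Nat.cast_nonneg j))
    | succ t ih =>
      rw [d_succ, h.succ (t + 1) (Nat.le_add_left 1 t), Nat.cast_mul, Nat.cast_add, hN1, mul_assoc,
        add_mul]
      refine mul_le_mul_of_nonneg_left (add_le_add (c_le j _) ih) ?_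
      rw [← hN1]
      exact Nat.cast_nonneg _
  have d_lim : ∀ t, Tendsto (fun j => (d j (t + 1) : ℝ) / j) atTop (𝓝 (δ (t + 1))) := by
    intro t
    induction t with
    | zero => exact tendsto_floor_mul_div h.one
    | succ t ih =>
      rw [h.succ (t + 1) (Nat.le_add_left 1 t)]
      refine (((tendsto_floor_mul_div (h.nonneg (t + 1))).add ih).const_mul
        ((N : ℝ) - 1)).congr fun j => ?_
      rw [d_succ, Nat.cast_mul, Nat.cast_add, hN1]
      simp only [c]
      ring
  have m_eq : ∀ j : ℕ, prefetched N j r = ⌊r / N * j⌋₊ := by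
    intro j
    rw [prefetched]
    congr 1
    ring
  have hc : ∀ j, ∑ i ∈ Finset.range (K - 1), (K - 2).choose i * c j (i + 1) ≤
      prefetched N j r := by
    intro j
    rw [m_eq]
    refine Nat.le_floor ?_
    push_cast
    calc ∑ i ∈ Finset.range (K - 1), ((K - 2).choose i : ℝ) * c j (i + 1)
        ≤ ∑ i ∈ Finset.range (K - 1), ((K - 2).choose i : ℝ) * (γ (i + 1) * j) := by
          gcongr with i hi
          exact c_le j _
      _ = (∑ i ∈ Finset.range (K - 1), ((K - 2).choose i : ℝ) * γ (i + 1)) * j := by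
          rw [Finset.sum_mul]; simp only [mul_assoc]
      _ ≤ r / N * j := by gcongr; exact h.cached
  have hL : ∀ j, N * (prefetched N j r +
      ∑ i ∈ Finset.range K, (K - 1).choose i * d j (i + 1)) ≤ j := by
    intro j
    have h1 : (prefetched N j r : ℝ) ≤ r / N * j := by
      rw [m_eq]
      exact Nat.floor_le (by positivity)
    have h2 : ∑ i ∈ Finset.range K, ((K - 1).choose i : ℝ) * d j (i + 1) ≤
        (∑ i ∈ Finset.range K, ((K - 1).choose i : ℝ) * δ (i + 1)) * j := by
      rw [Finset.sum_mul]
      refine Finset.sum_le_sum fun i _ => ?_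
      rw [mul_assoc]
      exact mul_le_mul_of_nonneg_left (d_le j i) (Nat.cast_nonneg _)
    have h3 : (N : ℝ) * (prefetched N j r +
        ∑ i ∈ Finset.range K, ((K - 1).choose i : ℝ) * d j (i + 1)) ≤ j := by
      refine (mul_le_mul_of_nonneg_left (add_le_add h1 h2) hN0.le).trans (le_of_eq ?_)
      have : (N : ℝ) * (r / N) = r := by field_simp
      linear_combination (j : ℝ) * h.desired + (j : ℝ) * this
    exact_mod_cast h3
  choose S hpriv hequiv hcost using fun j =>
    exists_scheme (N := N) (K := K) (d := d j) (c := c j) rfl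
      (fun t ht => by obtain ⟨t, rfl⟩ := Nat.exists_eq_add_of_le' ht; exact (d_succ j t).le)
      (hc j) (hL j)
  refine ⟨fun j => j, S, tendsto_id, hpriv, fun θ => ?_, fun θ => ?_⟩
  · have hlim : Tendsto (fun j : ℕ => 1 - (N : ℝ) * ((⌊r / N * j⌋₊ : ℝ) / j +
        ∑ i ∈ Finset.range K, ((K - 1).choose i : ℝ) * ((d j (i + 1) : ℝ) / j))) atTop
        (𝓝 0) := by
      have h0 : 1 - (N : ℝ) * (r / N + ∑ i ∈ Finset.range K, ((K - 1).choose i : ℝ) * δ (i + 1)) =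
          0 := by
        have : (N : ℝ) * (r / N) = r := by field_simp
        linear_combination -h.desired - this
      rw [← h0]
      exact tendsto_const_nhds.sub (((tendsto_floor_mul_div hr).add
        (tendsto_finsetSum _ fun i _ => (d_lim i).const_mul _)).const_mul _)
    refine tendsto_of_tendsto_of_tendsto_of_le_of_le' tendsto_const_nhds hlim ?_ ?_
    · exact Eventually.of_forall fun j =>
        div_nonneg (condEntropy_nonneg _ _ _) (Nat.cast_nonneg j)
    · filter_upwards [eventually_gt_atTop 0] with j hj
      have hj' : (0 : ℝ) < j := by exact_mod_cast hj
      have := hequiv j θ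
      rw [div_le_iff₀ hj']
      refine this.trans (le_of_eq ?_)
      rw [m_eq]
      push_cast
      have e : ∑ i ∈ Finset.range K, ((K - 1).choose i : ℝ) * ((d j (i + 1) : ℝ) / j) =
          (∑ i ∈ Finset.range K, ((K - 1).choose i : ℝ) * (d j (i + 1) : ℝ)) / j := by
        rw [Finset.sum_div]; simp only [mul_div_assoc]
      rw [e]
      field_simp
  · have d_lim' : ∀ t, Tendsto (fun j => (d j t : ℝ) / j) atTop (𝓝 (δ t)) := by
      rintro (_ | t)
      · rw [h.zero]
        simp [d, sumCount]
      · exact d_lim t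
    rw [← h.cost]
    refine ((tendsto_finsetSum (Finset.range (K + 1)) fun t _ =>
      (d_lim' t).const_mul (K.choose t : ℝ)).const_mul (N : ℝ)).congr fun j => ?_
    rw [hcost]
    push_cast
    rw [mul_div_assoc, Finset.sum_div]
    simp only [mul_div_assoc]

/-! ### The corner points -/

/-- The denominator of the corner ratio `r_s`. -/
noncomputable def cornerDenom (N K s : ℕ) : ℝ :=
  ((K - 2).choose (s - 1) : ℝ) +
    ∑ i ∈ Finset.range (K - s), ((K - 1).choose (s + i) : ℝ) * ((N : ℝ) - 1) ^ (i + 1)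

theorem cornerDenom_pos {N K s : ℕ} (hN : 1 ≤ N) (hs : 1 ≤ s) (hsK : s < K) :
    0 < cornerDenom N K s := by
  have h1 : 0 ≤ (N : ℝ) - 1 := sub_nonneg.2 (by exact_mod_cast hN)
  have h2 : 0 < (K - 2).choose (s - 1) := Nat.choose_pos (by omega)
  unfold cornerDenom
  positivity

theorem cornerRatio_eq {N K s : ℕ} (hs : 1 ≤ s) (hsK : s < K) :
    cornerRatio N K s = ((K - 2).choose (s - 1) : ℝ) / cornerDenom N K s := by
  rw [cornerRatio, if_neg (by omega), if_neg (by omega), cornerDenom]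

theorem cornerCost_eq {N K s : ℕ} (hs : 1 ≤ s) (hsK : s < K) :
    cornerCost N K s =
      (∑ i ∈ Finset.range (K - s), (K.choose (s + 1 + i) : ℝ) * ((N : ℝ) - 1) ^ (i + 1)) /
        cornerDenom N K s := by
  rw [cornerCost, if_neg (by omega), if_neg (by omega), cornerDenom]

theorem sum_choose_succ_mul_pow (K : ℕ) (y : ℝ) :
    ∑ i ∈ Finset.range K, (K.choose (i + 1) : ℝ) * y ^ i = ∑ j ∈ Finset.range K, (y + 1) ^ j := by
  induction K with
  | zero => simp
  | succ K ih =>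
    rw [Finset.sum_range_succ (fun j => (y + 1) ^ j), ← ih, add_pow]
    simp only [Nat.choose_succ_succ, Nat.cast_add, add_mul, Finset.sum_add_distrib, one_pow,
      mul_one]
    rw [Finset.sum_range_succ (fun i => (K.choose (i + 1) : ℝ) * y ^ i) K, Nat.choose_succ_self,
      add_comm]
    simp [mul_comm]

/-- Without cache the downloaded sums of size `t` have proportion `(N - 1) ^ (t - 1) / N ^ K`. This
covers `N = 1`, where only plain bits are downloaded. -/
theorem isFeasibleWith_zero {N K : ℕ} (hN : 1 ≤ N) (hK : 1 ≤ K) :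
    IsFeasibleWith N K (cornerRatio N K 0) (cornerCost N K 0) (fun _ => 0)
      (fun t => if t = 0 then 0 else ((N : ℝ) - 1) ^ (t - 1) / (N : ℝ) ^ K) := by
  have hN0 : (0 : ℝ) < N := by exact_mod_cast hN
  have hN1 : 0 ≤ (N : ℝ) - 1 := sub_nonneg.2 (by exact_mod_cast hN)
  obtain ⟨M, rfl⟩ := Nat.exists_eq_add_of_le' hK
  have hr : cornerRatio N (M + 1) 0 = 0 := by simp [cornerRatio]
  refine ⟨fun t => le_rfl, by simp, by positivity, ?_, by simp [hr], ?_, ?_⟩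
  · intro t ht
    obtain ⟨t, rfl⟩ := Nat.exists_eq_add_of_le' ht
    simp only [Nat.add_eq_zero_iff, one_ne_zero, and_false, if_false, Nat.add_sub_cancel]
    ring
  · have h := add_pow ((N : ℝ) - 1) 1 M
    simp only [sub_add_cancel, one_pow, mul_one] at h
    simp only [hr, Nat.add_eq_zero_iff, one_ne_zero, and_false, if_false, Nat.add_sub_cancel,
      ← mul_div_assoc, ← Finset.sum_div]
    simp only [mul_comm (Nat.cast _ : ℝ) (((N : ℝ) - 1) ^ _)]
    rw [← h]
    field_simp
    ring
  · have h := sum_choose_succ_mul_pow (M + 1) ((N : ℝ) - 1)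
    simp only [sub_add_cancel] at h
    rw [Finset.sum_range_succ']
    simp only [Nat.add_eq_zero_iff, one_ne_zero, and_false, if_false, Nat.add_sub_cancel,
      if_true, mul_zero, add_zero, ← mul_div_assoc, ← Finset.sum_div]
    rw [h, cornerCost, if_pos rfl, ← Finset.sum_range_reflect, Finset.mul_sum, Finset.sum_div]
    refine Finset.sum_congr rfl fun j hj => ?_
    have hj' : j ≤ M := by have := Finset.mem_range.1 hj; omega
    have e : M + 1 = (M + 1 - 1 - j) + j + 1 := by omega
    conv_lhs => rw [e]
    simp only [Nat.add_sub_cancel, pow_add, pow_one]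
    field_simp

/-- With everything cached nothing is downloaded. -/
theorem isFeasibleWith_top {N K s : ℕ} (hs : 1 ≤ s) (hsK : K ≤ s) :
    IsFeasibleWith N K (cornerRatio N K s) (cornerCost N K s) (fun _ => 0) (fun _ => 0) := by
  have hr : cornerRatio N K s = 1 := by rw [cornerRatio, if_neg (by omega), if_pos hsK]
  have hx : cornerCost N K s = 0 := by rw [cornerCost, if_neg (by omega), if_pos hsK]
  refine ⟨fun t => le_rfl, rfl, le_rfl, by simp, ?_, by simp [hr], by simp [hx]⟩
  rw [hr]
  simp

/-- At an inner corner all cached sums have the size `s`, and the proportions of the downloaded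
sums grow by a factor `N - 1` with each further message. -/
theorem isFeasibleWith_inner {N K s : ℕ} (hN : 1 ≤ N) (hs : 1 ≤ s) (hsK : s < K) :
    IsFeasibleWith N K (cornerRatio N K s) (cornerCost N K s)
      (fun t => if t = s then 1 / (N * cornerDenom N K s) else 0)
      (fun t => if s < t then ((N : ℝ) - 1) ^ (t - s) / (N * cornerDenom N K s) else 0) := by
  have hN0 : (0 : ℝ) < N := by exact_mod_cast hN
  have hD := cornerDenom_pos hN hs hsK
  rw [cornerRatio_eq hs hsK, cornerCost_eq hs hsK]
  refine ⟨fun t => ?_, by simp, ?_, fun t ht => ?_, ?_, ?_, ?_⟩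
  · split_ifs <;> positivity
  · simp only [if_neg (not_lt.2 hs), le_refl]
  · rcases lt_trichotomy t s with h | rfl | h
    · simp [h.ne, not_lt.2 h.le, show ¬ s < t + 1 by omega]
    · simp
      ring
    · rw [if_pos (by omega), if_neg h.ne', if_pos h, show t + 1 - s = (t - s) + 1 by omega]
      ring
  · rw [Finset.sum_eq_single_of_mem (s - 1) (by rw [Finset.mem_range]; omega)]
    · rw [if_pos (by omega)]
      apply le_of_eq
      field_simp
    · intro i _ hi
      rw [if_neg (by omega), mul_zero]
  · have e : ∑ i ∈ Finset.range K, ((K - 1).choose i : ℝ) *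
        (if s < i + 1 then ((N : ℝ) - 1) ^ (i + 1 - s) / (N * cornerDenom N K s) else 0) =
        (∑ i ∈ Finset.range (K - s), ((K - 1).choose (s + i) : ℝ) * ((N : ℝ) - 1) ^ (i + 1)) /
          (N * cornerDenom N K s) := by
      rw [show Finset.range K = Finset.range (s + (K - s)) by rw [Nat.add_sub_cancel' hsK.le],
        Finset.sum_range_add, Finset.sum_eq_zero, zero_add, Finset.sum_div]
      · refine Finset.sum_congr rfl fun i _ => ?_
        rw [if_pos (by omega), show s + i + 1 - s = i + 1 by omega, mul_div_assoc]
      · intro i hi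
        rw [Finset.mem_range] at hi
        rw [if_neg (by omega), mul_zero]
    rw [e]
    field_simp
    rfl
  · have e : ∑ t ∈ Finset.range (K + 1), (K.choose t : ℝ) *
        (if s < t then ((N : ℝ) - 1) ^ (t - s) / (N * cornerDenom N K s) else 0) =
        (∑ i ∈ Finset.range (K - s), (K.choose (s + 1 + i) : ℝ) * ((N : ℝ) - 1) ^ (i + 1)) /
          (N * cornerDenom N K s) := by
      rw [show Finset.range (K + 1) = Finset.range (s + 1 + (K - s)) by
          rw [Nat.add_right_comm, Nat.add_sub_cancel' hsK.le],
        Finset.sum_range_add, Finset.sum_eq_zero, zero_add, Finset.sum_div]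
      · refine Finset.sum_congr rfl fun i _ => ?_
        rw [if_pos (by omega), show s + 1 + i - s = i + 1 by omega, mul_div_assoc]
      · intro i hi
        rw [Finset.mem_range] at hi
        rw [if_neg (by omega), mul_zero]
    rw [e]
    field_simp

theorem exists_isFeasibleWith {N K : ℕ} (hN : 1 ≤ N) (hK : 1 ≤ K) (s : ℕ) :
    ∃ γ δ, IsFeasibleWith N K (cornerRatio N K s) (cornerCost N K s) γ δ := by
  rcases Nat.eq_zero_or_pos s with rfl | hs
  · exact ⟨_, _, isFeasibleWith_zero hN hK⟩
  · rcases lt_or_ge s K with h | h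
    · exact ⟨_, _, isFeasibleWith_inner hN hs h⟩
    · exact ⟨_, _, isFeasibleWith_top hs h⟩

/-- The quotients of consecutive binomial coefficients of `K - 1` at `s + i` are at most those of
`K - 2` at `s - 1`. -/
theorem choose_mul_choose_le (K s i : ℕ) (hs : 1 ≤ s) (hsK : s + 1 < K) :
    (K - 1).choose (s + 1 + i) * (K - 2).choose (s - 1) ≤
      (K - 1).choose (s + i) * (K - 2).choose s := by
  obtain ⟨a, rfl⟩ := Nat.exists_eq_add_of_le' hs
  obtain ⟨b, rfl⟩ : ∃ b, K = a + b + 3 := ⟨K - (a + 3), by omega⟩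
  have e1 : a + b + 3 - 1 = a + b + 2 := rfl
  have e2 : a + b + 3 - 2 = a + b + 1 := rfl
  rw [e1, e2, Nat.add_sub_cancel]
  have h1 := Nat.choose_succ_right_eq (a + b + 2) (a + 1 + i)
  have h2 := Nat.choose_succ_right_eq (a + b + 1) a
  rw [show a + 1 + i + 1 = a + 1 + 1 + i by ring] at h1
  rw [show a + b + 1 - a = b + 1 by omega] at h2
  generalize (a + b + 2).choose (a + 1 + 1 + i) = p at *
  generalize (a + b + 2).choose (a + 1 + i) = q at *
  generalize (a + b + 1).choose (a + 1) = u at *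
  generalize (a + b + 1).choose a = v at *
  have h3 : p * (a + 1) ≤ q * (b + 1) :=
    calc p * (a + 1) ≤ p * (a + 1 + 1 + i) := Nat.mul_le_mul_left _ (by omega)
      _ = q * (a + b + 2 - (a + 1 + i)) := h1
      _ ≤ q * (b + 1) := Nat.mul_le_mul_left _ (by omega)
  refine Nat.le_of_mul_le_mul_right (c := a + 1) ?_ (Nat.succ_pos a)
  calc p * v * (a + 1) = p * (a + 1) * v := by ring
    _ ≤ q * (b + 1) * v := Nat.mul_le_mul_right _ h3
    _ = q * u * (a + 1) := by rw [mul_assoc q u, h2]; ring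

theorem cornerRatio_lt_succ {N K s : ℕ} (hN : 2 ≤ N) (hs : s < K) :
    cornerRatio N K s < cornerRatio N K (s + 1) := by
  have hN1 : 0 < (N : ℝ) - 1 := sub_pos.2 (by exact_mod_cast hN)
  rcases Nat.eq_zero_or_pos s with rfl | hs1
  · rw [show cornerRatio N K 0 = 0 by simp [cornerRatio]]
    rcases Nat.lt_or_ge 1 K with h | h
    · rw [zero_add, cornerRatio_eq le_rfl h]
      have := cornerDenom_pos (N := N) (by omega) le_rfl h
      simp only [Nat.sub_self, Nat.choose_zero_right, Nat.cast_one]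
      positivity
    · rw [cornerRatio, if_neg (by omega), if_pos (by omega)]
      exact one_pos
  · have hD := cornerDenom_pos (N := N) (by omega) hs1 hs
    have hpos : ∀ t, t < K → 0 < ((K - 1).choose t : ℝ) := fun t ht => by
      exact_mod_cast Nat.choose_pos (by omega)
    rw [cornerRatio_eq hs1 hs]
    rcases Nat.lt_or_ge (s + 1) K with h | h
    · have hD' := cornerDenom_pos (N := N) (by omega) (Nat.le_add_left 1 s) h
      rw [cornerRatio_eq (Nat.le_add_left 1 s) h, div_lt_div_iff₀ hD hD', Nat.add_sub_cancel]
      have hC : 0 < ((K - 2).choose s : ℝ) := by exact_mod_cast Nat.choose_pos (by omega)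
      unfold cornerDenom
      rw [Nat.add_sub_cancel, mul_add, mul_add, mul_comm, Finset.mul_sum, Finset.mul_sum,
        show K - s = K - (s + 1) + 1 by omega, Finset.sum_range_succ, ← add_assoc]
      have h1 : ∑ i ∈ Finset.range (K - (s + 1)), ((K - 2).choose (s - 1) : ℝ) *
          (((K - 1).choose (s + 1 + i) : ℝ) * ((N : ℝ) - 1) ^ (i + 1)) ≤
          ∑ i ∈ Finset.range (K - (s + 1)), ((K - 2).choose s : ℝ) *
            (((K - 1).choose (s + i) : ℝ) * ((N : ℝ) - 1) ^ (i + 1)) := by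
        refine Finset.sum_le_sum fun i _ => ?_
        rw [← mul_assoc, ← mul_assoc]
        refine mul_le_mul_of_nonneg_right ?_ (by positivity)
        rw [mul_comm, mul_comm ((K - 2).choose s : ℝ)]
        exact_mod_cast choose_mul_choose_le K s i hs1 h
      have h2 : 0 < ((K - 2).choose s : ℝ) * (((K - 1).choose (s + (K - (s + 1))) : ℝ) *
          ((N : ℝ) - 1) ^ (K - (s + 1) + 1)) := by
        have := hpos (s + (K - (s + 1))) (by omega)
        positivity
      linarith
    · rw [cornerRatio, if_neg (by omega), if_pos h, div_lt_one hD, cornerDenom,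
        lt_add_iff_pos_right]
      refine Finset.sum_pos (fun i hi => ?_) ⟨0, by rw [Finset.mem_range]; omega⟩
      rw [Finset.mem_range] at hi
      have := hpos (s + i) (by omega)
      positivity

theorem optimalCost_le {N K : ℕ} {r x : ℝ} (h : IsAchievable N K r x) :
    optimalCost N K r ≤ (x : EReal) :=
  iInf₂_le x h

end CachePIR

theorem theorem1 (N K : ℕ) (hN : 1 ≤ N) (hK : 1 ≤ K) :
    (∀ s : ℕ, s ≤ K →
      CachePIR.IsAchievable N K (CachePIR.cornerRatio N K s) (CachePIR.cornerCost N K s) ∧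
      CachePIR.optimalCost N K (CachePIR.cornerRatio N K s) ≤
        ((CachePIR.cornerCost N K s : ℝ) : EReal)) ∧
    (∀ s : ℕ, s < K → ∀ α : ℝ, 0 < α → α < 1 → ∀ r : ℝ,
      r = α * CachePIR.cornerRatio N K s + (1 - α) * CachePIR.cornerRatio N K (s + 1) →
      CachePIR.IsAchievable N K r
        (α * CachePIR.cornerCost N K s + (1 - α) * CachePIR.cornerCost N K (s + 1)) ∧
      CachePIR.optimalCost N K r ≤
        ((α * CachePIR.cornerCost N K s + (1 - α) * CachePIR.cornerCost N K (s + 1) : ℝ) :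
          EReal)) ∧
    (2 ≤ N → StrictMonoOn (CachePIR.cornerRatio N K) (Set.Iic K)) := by
  refine ⟨fun s _ => ?_, fun s _ α hα hα1 r hr => ?_, fun hN2 => ?_⟩
  · obtain ⟨γ, δ, h⟩ := CachePIR.exists_isFeasibleWith hN hK s
    exact ⟨h.isAchievable hN, CachePIR.optimalCost_le (h.isAchievable hN)⟩
  · obtain ⟨γ, δ, h⟩ := CachePIR.exists_isFeasibleWith hN hK s
    obtain ⟨γ', δ', h'⟩ := CachePIR.exists_isFeasibleWith hN hK (s + 1)
    have hc := (h.convexComb h' hα.le (sub_nonneg.2 hα1.le) (by ring)).isAchievable hN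
    rw [← hr] at hc
    exact ⟨hc, CachePIR.optimalCost_le hc⟩
  · refine strictMonoOn_of_lt_succ Set.ordConnected_Iic fun s _ _ hs => ?_
    exact CachePIR.cornerRatio_lt_succ hN2 (Nat.lt_of_succ_le hs)
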